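/- Proposition (Admissible NIM-reps for group rings). Let $\Bbbk$ be an algebraically closed field and $G$ a finite group. Let $R(G)=(\mathbb Z G,G)$ be the group fusion ring, with involution $g^*=g^{-1}$. For a subgroup $H\subseteq G$ let $M(H)$ be the NIM-rep of $R(G)$ on $\mathbb Z[G/H]$ with basis the left cosets $m_{gH}$, on which $G$ acts by left translation. Here a NIM-rep of a fusion ring $(R,\{b_i\})$ is an $R$-module with a fixed $\mathbb Z$-basis $\{m_l\}$ such that every $b_i m_l$ has non-negative coefficients and $(b_i m_l,m_k)=(m_l,b_{i^*}m_k)$ for the form $(m_l,m_k)=\delta_{l,k}$. It is irreducible if it is nonzero and no proper nonempty subset of its basis spans a submodule. A realization of a NIM-rep $M$ of $(R,\{b_i\})$ consists of a fusion category $\mathcal C$ over $\Bbbk$ with an isomorphism of based rings $\mathrm{Gr}(\mathcal C)\cong R$ (we write $b_i$ also for the corresponding simple object of $\mathcal C$), an algebra $B$ in $\mathcal C$ such that the left $\mathcal C$-module category $\mathsf{Mod}_{\mathcal C}\text{-}B$ of right $B$-modules is semisimple, and an isomorphism $\mathrm{Gr}(\mathsf{Mod}_{\mathcal C}\text{-}B)\cong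 M$ of $R$-modules that matches the classes of simple modules with the basis of $M$. A NIM-rep is admissible if it has a realization. A group algebra of $H$ in $\mathcal C$, possibly twisted, is an algebra $E$ with $E\cong\bigoplus_{h\in H}b_h$ as an object, such that the multiplication restricts to isomorphisms $b_h\otimes b_{h'}\to b_{hh'}$ for all $h,h'\in H$. (1) Every irreducible NIM-rep of $R(G)$ is equivalent to $M(H)$ for some subgroup $H\subseteq G$, and it is admissible; in each of its realizations the fusion category is pointed (all simple objects are invertible). (2) For every subgroup $H\subseteq G$ the NIM-rep $M(H)$ is irreducible, and it has a realization $(\mathcal C,B)$ with $\mathcal C$ pointed in which $B$ is a group algebra of $H$, so that $B\cong\bigoplus_{h\in H}b_h$, and the basis element $m_H$ corresponds to the regular module $B$. (3) In every realization $(\mathcal C,B)$ of $M(H)$, let $N$ be the simple $B$-module that corresponds to $m_H$. Then the internal endomorphism algebra $\underline{\mathrm{Hom}}(N,N)$ in $\mathcal C$ exists and is a group algebra of $H$; in particular $\underline{\mathrm{Hom}}(N,N)\cong\bigoplus_{h\in H}b_h$. -/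

import Mathlib

open CategoryTheory CategoryTheory.Limits CategoryTheory.MonoidalCategory

universe u v w₁ w₂ w₃ w₄

namespace GroupNIM

noncomputable section

/-! ### Fusion rings and NIM-reps -/

/-- A fusion ring structure on `R`, with finite label set `I`: a unital based ring of finite
rank. -/
structure FusionRing (R : Type*) [Ring R] (I : Type*) [Finite I] where
  /-- the distinguished basis `b_i` -/
  basis : Module.Basis I ℤ R
  mul_nonneg : ∀ i j k, 0 ≤ basis.repr (basis i * basis j) k
  /-- the label of the unit -/
  unit : I
  basis_unit : basis unit = 1
  /-- the involution `i ↦ i*` -/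
  star : I → I
  star_star : ∀ i, star (star i) = i
  /-- the induced additive map is an anti-involution -/
  star_mul : ∀ x y : R,
    basis.constr ℤ (fun i => basis (star i)) (x * y) =
      basis.constr ℤ (fun i => basis (star i)) y * basis.constr ℤ (fun i => basis (star i)) x
  /-- `τ (b_i b_j) = 1` if `i = j*` -/
  tau_eq_one : ∀ i j, i = star j → basis.repr (basis i * basis j) unit = 1
  /-- `τ (b_i b_j) = 0` if `i ≠ j*` -/
  tau_eq_zero : ∀ i j, i ≠ star j → basis.repr (basis i * basis j) unit = 0

/-- The symmetric bilinear form `(m_l, m_k) = δ_{l,k}` attached to a `ℤ`-basis. -/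
def basisForm {A L : Type*} [AddCommGroup A] (m : Module.Basis L ℤ A) (x y : A) : ℤ :=
  (m.repr x).sum fun l c => c * m.repr y l

/-- A NIM-rep `(A, M)` over a fusion ring, with `M` indexed by `L`. -/
structure NIMRep {R I : Type*} [Ring R] [Finite I] (F : FusionRing R I)
    (A : Type*) [AddCommGroup A] [Module R A] (L : Type*) where
  /-- the distinguished basis `m_l` -/
  basis : Module.Basis L ℤ A
  nonneg : ∀ i l k, 0 ≤ basis.repr (F.basis i • basis l) k
  /-- the rigidity condition -/
  rigid : ∀ i l k, basisForm basis (F.basis i • basis l) (basis k) =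
    basisForm basis (basis l) (F.basis (F.star i) • basis k)

/-- `S ⊆ L` spans a sub-NIM-rep if its `ℤ`-span is stable under the ring. -/
def NIMRep.IsSub {R I : Type*} [Ring R] [Finite I] {F : FusionRing R I}
    {A : Type*} [AddCommGroup A] [Module R A] {L : Type*} (N : NIMRep F A L) (S : Set L) : Prop :=
  ∀ r : R, ∀ a ∈ Submodule.span ℤ (N.basis '' S), r • a ∈ Submodule.span ℤ (N.basis '' S)

/-- A NIM-rep is irreducible if it is nonzero and has no proper nonzero sub-NIM-rep. -/
def NIMRep.IsIrreducible {R I : Type*} [Ring R] [Finite I] {F : FusionRing R I}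
    {A : Type*} [AddCommGroup A] [Module R A] {L : Type*} (N : NIMRep F A L) : Prop :=
  Nonempty L ∧ ∀ S : Set L, N.IsSub S → S = ∅ ∨ S = Set.univ

/-- Equivalence of NIM-reps: a bijection of bases that induces an isomorphism of modules. -/
def NIMRep.Equivalent {R I : Type*} [Ring R] [Finite I] {F : FusionRing R I}
    {A : Type*} [AddCommGroup A] [Module R A] {L : Type*}
    {A' : Type*} [AddCommGroup A'] [Module R A'] {L' : Type*}
    (N : NIMRep F A L) (N' : NIMRep F A' L') : Prop :=
  ∃ (e : L ≃ L') (f : A ≃ₗ[R] A'), ∀ l, f (N.basis l) = N'.basis (e l)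

/-! ### The group ring and its NIM-reps -/

/-- The `ℤ`-basis `G` of `ℤG`. -/
def groupBasis (G : Type*) : Module.Basis G ℤ (MonoidAlgebra ℤ G) :=
  ⟨MonoidAlgebra.coeffLinearEquiv ℤ⟩

lemma groupBasis_apply (G : Type*) (g : G) :
    groupBasis G g = MonoidAlgebra.single g 1 := by
  rw [← (groupBasis G).repr.injective.eq_iff, Module.Basis.repr_self]
  rfl

lemma groupBasis_mul {G : Type*} [Group G] (g h : G) :
    groupBasis G g * groupBasis G h = groupBasis G (g * h) := by
  simp [groupBasis_apply, MonoidAlgebra.single_mul_single]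

lemma repr_self_nonneg {A L : Type*} [AddCommGroup A] (m : Module.Basis L ℤ A) (l k : L) :
    0 ≤ m.repr (m l) k := by
  classical
  rw [Module.Basis.repr_self, Finsupp.single_apply]
  split_ifs <;> simp

/-- The group fusion ring `R(G) = (ℤG, G)`, with involution `g* = g⁻¹`. -/
def groupFusionRing (G : Type*) [Group G] [Finite G] : FusionRing (MonoidAlgebra ℤ G) G where
  basis := groupBasis G
  mul_nonneg i j k := by
    rw [groupBasis_mul]
    exact repr_self_nonneg _ _ _
  unit := 1
  basis_unit := groupBasis_apply G 1
  star := fun g => g⁻¹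
  star_star := inv_inv
  star_mul x y := by
    set f := (groupBasis G).constr ℤ (fun g : G => groupBasis G g⁻¹) with hf
    have key : (LinearMap.mul ℤ (MonoidAlgebra ℤ G)).compr₂ f =
        ((LinearMap.mul ℤ (MonoidAlgebra ℤ G)).flip.compl₁₂ f f) := by
      refine (groupBasis G).ext fun g => (groupBasis G).ext fun h => ?_
      simp [hf, groupBasis_mul, Module.Basis.constr_basis]
    simpa using LinearMap.congr_fun (LinearMap.congr_fun key x) y
  tau_eq_one i j h := by
    subst h
    simp [groupBasis_mul]
  tau_eq_zero i j h := by
    rw [groupBasis_mul, Module.Basis.repr_self]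
    exact Finsupp.single_eq_of_ne' (fun e => h (eq_inv_of_mul_eq_one_left e))

/-- `ℤ[G/H]` with the `ℤG`-module structure coming from left translation of cosets. -/
abbrev CosetModule {G : Type*} [Group G] (H : Subgroup G) : Type _ :=
  (Representation.ofMulAction ℤ G (G ⧸ H)).asModule

/-- The basis of `ℤ[G/H]` given by the left cosets. -/
def cosetBasis {G : Type*} [Group G] (H : Subgroup G) :
    Module.Basis (G ⧸ H) ℤ (CosetModule H) :=
  (groupBasis (G ⧸ H)).map (Representation.ofMulAction ℤ G (G ⧸ H)).asModuleEquiv.symm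

lemma smul_cosetBasis {G : Type*} [Group G] (H : Subgroup G) (g : G) (c : G ⧸ H) :
    groupBasis G g • cosetBasis H c = cosetBasis H (g • c) := by
  have h := Representation.asModuleEquiv_symm_map_rho (Representation.ofMulAction ℤ G (G ⧸ H)) g
    (groupBasis (G ⧸ H) c)
  rw [MonoidAlgebra.of_apply, ← groupBasis_apply, groupBasis_apply (G ⧸ H),
    Representation.ofMulAction_single, ← groupBasis_apply, ← groupBasis_apply] at h
  exact h.symm

/-- The NIM-rep `M(H)` over `R(G)`. -/
def cosetNIMRep {G : Type*} [Group G] [Finite G] (H : Subgroup G) :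
    NIMRep (groupFusionRing G) (CosetModule H) (G ⧸ H) where
  basis := cosetBasis H
  nonneg g l k := by
    change 0 ≤ (cosetBasis H).repr (groupBasis G g • cosetBasis H l) k
    rw [smul_cosetBasis]
    exact repr_self_nonneg _ _ _
  rigid g l k := by
    classical
    change basisForm (cosetBasis H) (groupBasis G g • cosetBasis H l) (cosetBasis H k) =
      basisForm (cosetBasis H) (cosetBasis H l) (groupBasis G g⁻¹ • cosetBasis H k)
    rw [smul_cosetBasis, smul_cosetBasis]
    simp only [basisForm, Module.Basis.repr_self, Finsupp.sum_single_index, zero_mul, one_mul,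
      Finsupp.single_apply]
    exact if_congr (by rw [inv_smul_eq_iff, eq_comm]) rfl rfl

/-! ### Semisimple categories, fusion categories, Grothendieck groups -/

/-- A semisimple category: abelian, and every object is a finite direct sum of simple objects. -/
class IsSemisimpleCategory (D : Type*) [Category* D] [Preadditive D] : Prop extends
    IsNormalMonoCategory D, IsNormalEpiCategory D, HasFiniteBiproducts D, HasKernels D,
    HasCokernels D where
  exists_decomposition : ∀ X : D, ∃ (n : ℕ) (S : Fin n → D),
    (∀ i, Simple (S i)) ∧ Nonempty (X ≅ ⨁ S)

/-- Isomorphism of simple objects. -/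
def simpleSetoid (D : Type*) [Category* D] [HasZeroMorphisms D] : Setoid {X : D // Simple X} where
  r X Y := Nonempty (X.1 ≅ Y.1)
  iseqv := ⟨fun _ => ⟨Iso.refl _⟩, fun ⟨e⟩ => ⟨e.symm⟩, fun ⟨e⟩ ⟨f⟩ => ⟨e ≪≫ f⟩⟩

/-- Isomorphism classes of simple objects. -/
def SimpleClass (D : Type*) [Category* D] [HasZeroMorphisms D] : Type _ :=
  Quotient (simpleSetoid D)

/-- A representative of an isomorphism class of simple objects. -/
def SimpleClass.rep {D : Type*} [Category* D] [HasZeroMorphisms D] (S : SimpleClass D) : D :=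
  (Quotient.out S).1

/-- A fusion category over `k`: a semisimple `k`-linear rigid monoidal category with bilinear
tensor product, finite-dimensional morphism spaces, finitely many simple objects up to isomorphism
and a simple unit. -/
class IsFusionCategory (k : Type*) [Field k] (C : Type*) [Category* C] [Preadditive C]
    [Linear k C] [MonoidalCategory C] [MonoidalPreadditive C] : Prop extends
    IsSemisimpleCategory C, MonoidalLinear k C where
  finite_hom : ∀ X Y : C, FiniteDimensional k (X ⟶ Y)
  finite_simples : Finite (SimpleClass C)
  simple_unit : Simple (𝟙_ C)
  rigid : Nonempty (RigidCategory C)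

/-- Fusion categories over `k`. -/
structure FusionCat (k : Type u) [Field k] where
  /-- the objects -/
  carrier : Type w₂
  [category : Category.{w₁} carrier]
  [preadditive : Preadditive carrier]
  [linear : Linear k carrier]
  [monoidal : MonoidalCategory carrier]
  [monoidalPreadditive : MonoidalPreadditive carrier]
  [isFusion : IsFusionCategory k carrier]

attribute [instance] FusionCat.category FusionCat.preadditive FusionCat.linear FusionCat.monoidal
  FusionCat.monoidalPreadditive FusionCat.isFusion

/-- A fusion category is pointed if all its simple objects are invertible. -/
def FusionCat.IsPointed {k : Type u} [Field k] (C : FusionCat.{u, w₁, w₂} k) : Prop :=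
  ∀ X : C.carrier, Simple X → ∃ Y : C.carrier, Nonempty (X ⊗ Y ≅ 𝟙_ C.carrier) ∧
    Nonempty (Y ⊗ X ≅ 𝟙_ C.carrier)

/-- The multiplicity `[X : S]` of a simple object `S` in an object `X` of a semisimple category
over an algebraically closed field `k`, as the dimension of `Hom(S, X)`. -/
def multiplicity (k : Type*) [Field k] {D : Type*} [Category* D] [Preadditive D] [Linear k D]
    (X : D) (S : SimpleClass D) : ℕ :=
  Module.finrank k (S.rep ⟶ X)

/-- The Grothendieck group: the free abelian group on the classes of simple objects. -/
abbrev Gr (D : Type*) [Category* D] [HasZeroMorphisms D] : Type _ := SimpleClass D →₀ ℤ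

/-- The class `[X] = ∑ [X : S] S` of an object. -/
def classOf (k : Type*) [Field k] {D : Type*} [Category* D] [Preadditive D] [Linear k D]
    (X : D) : Gr D :=
  ∑ᶠ S : SimpleClass D, Finsupp.single S (multiplicity k X S : ℤ)

/-- The multiplication of the Grothendieck ring, `S T = [S ⊗ T]` on simple classes. -/
def grMul (k : Type*) [Field k] (C : Type*) [Category* C] [Preadditive C] [Linear k C]
    [MonoidalCategory C] : Gr C →ₗ[ℤ] Gr C →ₗ[ℤ] Gr C :=
  Finsupp.linearCombination ℤ fun S : SimpleClass C =>
    Finsupp.linearCombination ℤ fun T : SimpleClass C => classOf k (S.rep ⊗ T.rep)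

open scoped MonoidalLeftAction in
/-- The action of `Gr(C)` on `Gr(D)` for a left `C`-module category `D`, `S T = [S ⊙ T]` on simple
classes. -/
def grAct (k : Type*) [Field k] (C : Type*) [Category* C] [Preadditive C]
    [MonoidalCategory C] (D : Type*) [Category* D] [Preadditive D] [Linear k D]
    [MonoidalLeftAction C D] : Gr C →ₗ[ℤ] Gr D →ₗ[ℤ] Gr D :=
  Finsupp.linearCombination ℤ fun S : SimpleClass C =>
    Finsupp.linearCombination ℤ fun T : SimpleClass D => classOf k (S.rep ⊙ₗ T.rep : D)

/-- The isomorphism of abelian groups `A ≃ Gr(D)` induced by a bijection from a `ℤ`-basis of `A`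
to the classes of simple objects. -/
def toGr {A L : Type*} [AddCommGroup A] (m : Module.Basis L ℤ A) {D : Type*} [Category* D]
    [HasZeroMorphisms D] (e : L ≃ SimpleClass D) : A ≃ₗ[ℤ] Gr D :=
  m.repr ≪≫ₗ Finsupp.domLCongr e

/-- An isomorphism of based rings from a fusion ring to `Gr(C)`. -/
structure GrRingIso (k : Type*) [Field k] {R I : Type*} [Ring R] [Finite I] (F : FusionRing R I)
    (C : Type*) [Category* C] [Preadditive C] [Linear k C] [MonoidalCategory C] where
  /-- the bijection of bases -/
  e : I ≃ SimpleClass C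
  map_one : toGr F.basis e 1 = classOf k (𝟙_ C)
  map_mul : ∀ x y : R, toGr F.basis e (x * y) = grMul k C (toGr F.basis e x) (toGr F.basis e y)

/-- An isomorphism from a NIM-rep to `Gr(D)`, for a left `C`-module category `D`, over a given
identification of the fusion ring with `Gr(C)`. -/
structure GrModIso {k : Type*} [Field k] {R I : Type*} [Ring R] [Finite I] {F : FusionRing R I}
    {C : Type*} [Category* C] [Preadditive C] [Linear k C] [MonoidalCategory C]
    (σ : GrRingIso k F C) {A : Type*} [AddCommGroup A] [Module R A] {L : Type*}
    (N : NIMRep F A L) (D : Type*) [Category* D] [Preadditive D] [Linear k D]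
    [MonoidalLeftAction C D] where
  /-- the bijection of bases -/
  e : L ≃ SimpleClass D
  map_smul : ∀ (r : R) (a : A),
    toGr N.basis e (r • a) = grAct k C D (toGr F.basis σ.e r) (toGr N.basis e a)

/-! ### Right modules over an algebra in a monoidal category -/

section RightMod

open MonObj

variable {C : Type w₂} [Category.{w₁} C] [MonoidalCategory C]

/-- Right modules over an algebra `A` in `C`. -/
structure RightMod (A : C) [MonObj A] where
  /-- the underlying object -/
  X : C
  /-- the action `X ⊗ A ⟶ X` -/
  act : X ⊗ A ⟶ X
  act_one : X ◁ η[A] ≫ act = (ρ_ X).hom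
  act_assoc : act ▷ A ≫ act = (α_ X A A).hom ≫ X ◁ μ[A] ≫ act

namespace RightMod

variable {A : C} [MonObj A]

/-- Morphisms of right modules. -/
@[ext]
structure Hom (M N : RightMod A) where
  /-- the underlying morphism -/
  hom : M.X ⟶ N.X
  act_hom : M.act ≫ hom = hom ▷ A ≫ N.act

instance : Category (RightMod A) where
  Hom M N := Hom M N
  id M := ⟨𝟙 M.X, by simp⟩
  comp f g := ⟨f.hom ≫ g.hom, by
    rw [← Category.assoc, f.act_hom, Category.assoc, g.act_hom, comp_whiskerRight,
      Category.assoc]⟩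
  id_comp f := Hom.ext (Category.id_comp f.hom)
  comp_id f := Hom.ext (Category.comp_id f.hom)
  assoc f g h := Hom.ext (Category.assoc f.hom g.hom h.hom)

@[ext]
lemma hom_ext {M N : RightMod A} {f g : M ⟶ N} (h : f.hom = g.hom) : f = g := Hom.ext h

@[simp] lemma id_hom (M : RightMod A) : (𝟙 M : M ⟶ M).hom = 𝟙 M.X := rfl

@[simp] lemma comp_hom {M N P : RightMod A} (f : M ⟶ N) (g : N ⟶ P) :
    (f ≫ g).hom = f.hom ≫ g.hom := rfl

/-- An isomorphism of underlying objects that is compatible with the actions. -/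
@[simps]
def mkIso {M N : RightMod A} (e : M.X ≅ N.X) (h : M.act ≫ e.hom = e.hom ▷ A ≫ N.act) :
    M ≅ N where
  hom := ⟨e.hom, h⟩
  inv := ⟨e.inv, by
    rw [Iso.comp_inv_eq, Category.assoc, h, ← Category.assoc, ← comp_whiskerRight]
    simp⟩
  hom_inv_id := by ext; simp
  inv_hom_id := by ext; simp

/-- `A` as a right module over itself. -/
@[simps]
def regular (A : C) [MonObj A] : RightMod A where
  X := A
  act := μ[A]
  act_one := MonObj.mul_one A
  act_assoc := MonObj.mul_assoc A

/-- The right module `X ⊗ M`, for `X` in `C` and a right module `M`. -/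
@[simps]
def tensorObj (X : C) (M : RightMod A) : RightMod A where
  X := X ⊗ M.X
  act := (α_ X M.X A).hom ≫ X ◁ M.act
  act_one := by simp [← MonoidalCategory.whiskerLeft_comp, M.act_one]
  act_assoc := by
    have h := congrArg (fun f => X ◁ f) M.act_assoc
    simp only [MonoidalCategory.whiskerLeft_comp] at h
    simp [h]

lemma tensorLeft_compat {X Y : C} (f : X ⟶ Y) (M : RightMod A) :
    ((α_ X M.X A).hom ≫ X ◁ M.act) ≫ f ▷ M.X =
      (f ▷ M.X) ▷ A ≫ (α_ Y M.X A).hom ≫ Y ◁ M.act := by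
  rw [Category.assoc, whisker_exchange]
  simp

lemma tensorRight_compat (X : C) {M N : RightMod A} (f : M ⟶ N) :
    ((α_ X M.X A).hom ≫ X ◁ M.act) ≫ X ◁ f.hom =
      (X ◁ f.hom) ▷ A ≫ (α_ X N.X A).hom ≫ X ◁ N.act := by
  rw [Category.assoc, ← MonoidalCategory.whiskerLeft_comp, f.act_hom]
  simp

lemma assoc_compat (X Y : C) (M : RightMod A) :
    ((α_ (X ⊗ Y) M.X A).hom ≫ (X ⊗ Y) ◁ M.act) ≫ (α_ X Y M.X).hom =
      (α_ X Y M.X).hom ▷ A ≫ (α_ X (Y ⊗ M.X) A).hom ≫ X ◁ ((α_ Y M.X A).hom ≫ Y ◁ M.act) := by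
  simp

lemma unit_compat (M : RightMod A) :
    ((α_ (𝟙_ C) M.X A).hom ≫ 𝟙_ C ◁ M.act) ≫ (λ_ M.X).hom = (λ_ M.X).hom ▷ A ≫ M.act := by
  simp

/-- Right modules form a left `C`-module category, with `X ⊙ M = X ⊗ M`. -/
instance : MonoidalLeftAction C (RightMod A) where
  actionObj X M := tensorObj X M
  actionHomLeft f M := ⟨f ▷ M.X, tensorLeft_compat f M⟩
  actionHomRight X _ _ f := ⟨X ◁ f.hom, tensorRight_compat X f⟩
  actionAssocIso X Y M := mkIso (α_ X Y M.X) (assoc_compat X Y M)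
  actionUnitIso M := mkIso (λ_ M.X) (unit_compat M)
  actionHom_def _ _ := rfl
  actionHomRight_id X M := hom_ext (MonoidalCategory.whiskerLeft_id X M.X)
  id_actionHomLeft X M := hom_ext (MonoidalCategory.id_whiskerRight X M.X)
  actionHom_comp {X X' X''} {M M' M''} f₁ f₂ g₁ g₂ := hom_ext <| by
    change (f₁ ≫ f₂) ▷ M.X ≫ X'' ◁ (g₁.hom ≫ g₂.hom) =
      (f₁ ▷ M.X ≫ X' ◁ g₁.hom) ≫ f₂ ▷ M'.X ≫ X'' ◁ g₂.hom
    simp [whisker_exchange_assoc]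
  actionAssocIso_hom_naturality {X X' Y Y'} {M M'} f g h := hom_ext <| by
    change ((f ⊗ₘ g) ▷ M.X ≫ (X' ⊗ Y') ◁ h.hom) ≫ (α_ X' Y' M'.X).hom =
      (α_ X Y M.X).hom ≫ f ▷ (Y ⊗ M.X) ≫ X' ◁ (g ▷ M.X ≫ Y' ◁ h.hom)
    simp [MonoidalCategory.tensorHom_def]
  actionUnitIso_hom_naturality f := hom_ext
    (MonoidalLeftAction.actionUnitIso_hom_naturality (C := C) f.hom)
  whiskerLeft_actionHomLeft c _ _ f d := hom_ext
    (MonoidalLeftAction.whiskerLeft_actionHomLeft c f d.X)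
  whiskerRight_actionHomLeft c f d := hom_ext
    (MonoidalLeftAction.whiskerRight_actionHomLeft c f d.X)
  associator_actionHom c₁ c₂ c₃ d := hom_ext
    (MonoidalLeftAction.associator_actionHom c₁ c₂ c₃ d.X)
  leftUnitor_actionHom c d := hom_ext (MonoidalLeftAction.leftUnitor_actionHom c d.X)
  rightUnitor_actionHom c d := hom_ext (MonoidalLeftAction.rightUnitor_actionHom c d.X)

section Preadditive

variable [Preadditive C] [MonoidalPreadditive C]

instance (M N : RightMod A) : Zero (M ⟶ N) := ⟨⟨0, by simp⟩⟩

instance (M N : RightMod A) : Add (M ⟶ N) :=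
  ⟨fun f g => ⟨f.hom + g.hom, by simp [f.act_hom, g.act_hom]⟩⟩

instance (M N : RightMod A) : Neg (M ⟶ N) := ⟨fun f => ⟨-f.hom, by
  rw [Preadditive.comp_neg, f.act_hom, eq_comm, ← add_eq_zero_iff_eq_neg, ← Preadditive.add_comp,
    ← MonoidalPreadditive.add_whiskerRight, neg_add_cancel, MonoidalPreadditive.zero_whiskerRight,
    zero_comp]⟩⟩

@[simp] lemma zero_hom (M N : RightMod A) : (0 : M ⟶ N).hom = 0 := rfl

@[simp] lemma add_hom {M N : RightMod A} (f g : M ⟶ N) : (f + g).hom = f.hom + g.hom := rfl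

@[simp] lemma neg_hom {M N : RightMod A} (f : M ⟶ N) : (-f).hom = -f.hom := rfl

instance (M N : RightMod A) : AddCommGroup (M ⟶ N) where
  add_assoc _ _ _ := hom_ext (add_assoc _ _ _)
  zero_add _ := hom_ext (zero_add _)
  add_zero _ := hom_ext (add_zero _)
  add_comm _ _ := hom_ext (add_comm _ _)
  neg_add_cancel _ := hom_ext (neg_add_cancel _)
  nsmul := nsmulRec
  zsmul := zsmulRec

instance : Preadditive (RightMod A) where
  add_comp _ _ _ _ _ _ := hom_ext (Preadditive.add_comp _ _ _ _ _ _)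
  comp_add _ _ _ _ _ _ := hom_ext (Preadditive.comp_add _ _ _ _ _ _)

variable {k : Type u} [Field k] [Linear k C] [MonoidalLinear k C]

instance (M N : RightMod A) : SMul k (M ⟶ N) :=
  ⟨fun r f => ⟨r • f.hom, by simp [f.act_hom]⟩⟩

@[simp] lemma smul_hom {M N : RightMod A} (r : k) (f : M ⟶ N) : (r • f).hom = r • f.hom := rfl

instance : Linear k (RightMod A) where
  homModule _ _ :=
    { one_smul := fun _ => hom_ext (one_smul k _)
      mul_smul := fun _ _ _ => hom_ext (mul_smul _ _ _)
      smul_zero := fun _ => hom_ext (smul_zero _)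
      smul_add := fun _ _ _ => hom_ext (smul_add _ _ _)
      add_smul := fun _ _ _ => hom_ext (add_smul _ _ _)
      zero_smul := fun _ => hom_ext (zero_smul k _) }
  smul_comp _ _ _ _ _ _ := hom_ext (Linear.smul_comp _ _ _ _ _ _)
  comp_smul _ _ _ _ _ _ := hom_ext (Linear.comp_smul _ _ _ _ _ _)

end Preadditive

end RightMod

end RightMod

/-! ### Admissibility and algebra objects -/

/-- A realization of a NIM-rep `N` over `F`: a fusion category `C` over `k` with `Gr(C) ≅ F`, and
an algebra `B` in `C` whose category of right modules is a semisimple left `C`-module category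
with Grothendieck group isomorphic to `N`. -/
structure Realization (k : Type u) [Field k] {R I : Type*} [Ring R] [Finite I]
    {F : FusionRing R I} {A : Type*} [AddCommGroup A] [Module R A] {L : Type*}
    (N : NIMRep F A L) where
  /-- the fusion category -/
  cat : FusionCat.{u, w₁, w₂} k
  /-- the identification of its Grothendieck ring -/
  ringIso : GrRingIso k F cat.carrier
  /-- the algebra -/
  alg : cat.carrier
  [mon : MonObj alg]
  [semisimple : IsSemisimpleCategory (RightMod alg)]
  /-- the identification of the Grothendieck group of the category of modules -/
  modIso : GrModIso ringIso N (RightMod alg)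

attribute [instance] Realization.mon Realization.semisimple

/-- A NIM-rep is admissible (over `k`) if it has a realization. -/
def NIMRep.IsAdmissible (k : Type u) [Field k] {R I : Type*} [Ring R] [Finite I]
    {F : FusionRing R I} {A : Type*} [AddCommGroup A] [Module R A] {L : Type*}
    (N : NIMRep F A L) : Prop :=
  Nonempty (Realization.{u, w₁, w₂} k N)

/-- The simple object `b_i` of the fusion category of a realization. -/
def Realization.b {k : Type u} [Field k] {R I : Type*} [Ring R] [Finite I]
    {F : FusionRing R I} {A : Type*} [AddCommGroup A] [Module R A] {L : Type*}
    {N : NIMRep F A L} (ρ : Realization.{u, w₁, w₂} k N) (i : I) : ρ.cat.carrier :=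
  (ρ.ringIso.e i).rep

/-- The simple module corresponding to the basis element `m_l` in a realization. -/
def Realization.m {k : Type u} [Field k] {R I : Type*} [Ring R] [Finite I]
    {F : FusionRing R I} {A : Type*} [AddCommGroup A] [Module R A] {L : Type*}
    {N : NIMRep F A L} (ρ : Realization.{u, w₁, w₂} k N) (l : L) : RightMod ρ.alg :=
  (ρ.modIso.e l).rep

open scoped MonoidalLeftAction MonObj in
/-- The algebra `E`, together with its action on `N`, is the internal endomorphism algebra
`Hom(N, N)`: the morphisms `X ⟶ E` correspond to the morphisms `X ⊙ N ⟶ N`, by acting on `N`. -/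
def IsInternalEnd {C : Type*} [Category* C] [MonoidalCategory C] {D : Type*} [Category* D]
    [MonoidalLeftAction C D] (N : D) (E : C) [MonObj E] [ModObj E N] : Prop :=
  ∀ X : C, Function.Bijective
    (fun f : X ⟶ E => (f ⊵ₗ N ≫ ModObj.smul : (X ⊙ₗ N : D) ⟶ N))

open scoped MonObj in
/-- The algebra `E` is a (possibly twisted) group algebra of `H`: as an object it is the direct sum
`⨁_{h ∈ H} b_h`, and its multiplication maps `b_h ⊗ b_{h'}` isomorphically to `b_{h h'}`. -/
def IsGroupAlgebra {C : Type*} [Category* C] [MonoidalCategory C] {G : Type*} [Group G]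
    (b : G → C) (H : Subgroup G) (E : C) [MonObj E] : Prop :=
  ∃ j : ∀ h : H, b h ⟶ E, Nonempty (IsColimit (Cofan.mk E j)) ∧
    ∀ h h' : H, ∃ t : b h ⊗ b h' ≅ b (h * h' : H), (j h ⊗ₘ j h') ≫ μ[E] = t.hom ≫ j (h * h')

end

end GroupNIM

open GroupNIM

/-!
A NIM-rep of `ℤG` is a permutation representation: by rigidity the matrix of `g⁻¹` is the transpose
of that of `g`, and a non-negative integral matrix with inverse its transpose is a permutation
matrix (`NIMRep.exists_smul_basis`). Sub-NIM-reps are invariant subsets, so the irreducible NIM-reps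
are the transitive `G`-sets, that is the `G/H`.

In a fusion category whose Grothendieck ring is `ℤG`, the product `b_g ⊗ b_h` has the class of
`b_{gh}`, and an object with the class of a simple object is isomorphic to it
(`nonempty_iso_rep_of_classOf`). So `b_{g⁻¹}` is an inverse of `b_g`, and the category is pointed.

`M(H)` is realized by the group algebra of `H` in the category of finite-dimensional `G`-graded
vector spaces. The objects of that category are taken to be finite index sets with a degree for each
index, and the morphisms to be degree-preserving matrices, so that the tensor product is the
Kronecker product and all structural isomorphisms are permutation matrices. A module over the group
algebra is free on its components in a set of representatives of `G/H` (`GradedVec.isoFree`); hence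
every module is a direct sum of the free modules on lines, one for each coset, and these have only
scalar endomorphisms and no morphisms between different ones. A finite family of objects with these
properties makes a linear category semisimple, with the family as its simple objects
(`IsOrthogonalFamily.isSemisimpleCategory`): every morphism has a quasi-inverse and every idempotent
splits.

Let `N` be the simple module of the coset `H` in any realization of `M(H)`. The module `b_g ⊙ N` is
simple and isomorphic to `N` exactly if `g ∈ H`, so by Schur's lemma `⨁_{h ∈ H} b_h` represents
`X ↦ Hom(X ⊙ N, N)` (`isUniversalAction_sumAction`). The universal property equips it with an
algebra structure (`IsUniversalAction.monObj`), and it is unique, so every internal endomorphism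
algebra of `N` is of this form. Its multiplication on `b_h ⊗ b_{h'}` corresponds to the composite
isomorphism `b_h ⊙ b_{h'} ⊙ N ≅ b_h ⊙ N ≅ N`, which by Schur's lemma is a nonzero multiple of the
one induced from `b_{hh'}`.
-/

namespace GroupNIM

/-! ### Classes of objects in the Grothendieck group -/

/-- The class of a simple object. -/
def SimpleClass.of {D : Type*} [Category* D] [HasZeroMorphisms D] (X : D) [hX : Simple X] :
    SimpleClass D :=
  Quotient.mk (simpleSetoid D) ⟨X, hX⟩

section Classes

variable {D : Type*} [Category* D] [Preadditive D]

instance SimpleClass.simple_rep (S : SimpleClass D) : Simple S.rep := (Quotient.out S).2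

lemma SimpleClass.of_rep (S : SimpleClass D) : SimpleClass.of S.rep = S := Quotient.out_eq S

lemma SimpleClass.of_eq_of_iff {X Y : D} [Simple X] [Simple Y] :
    SimpleClass.of X = SimpleClass.of Y ↔ Nonempty (X ≅ Y) := Quotient.eq

lemma SimpleClass.nonempty_rep_of_iso (X : D) [Simple X] :
    Nonempty ((SimpleClass.of X).rep ≅ X) :=
  SimpleClass.of_eq_of_iff.1 (SimpleClass.of_rep _)

variable (k : Type*) [Field k] [IsAlgClosed k] [Linear k D] [HasKernels D]
  [∀ X Y : D, FiniteDimensional k (X ⟶ Y)]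

lemma multiplicity_self (X : D) [Simple X] : multiplicity k X (SimpleClass.of X) = 1 :=
  (finrank_hom_simple_simple_eq_one_iff k _ X).2 (SimpleClass.nonempty_rep_of_iso X)

lemma multiplicity_eq_zero (X : D) [Simple X] {S : SimpleClass D} (h : S ≠ SimpleClass.of X) :
    multiplicity k X S = 0 :=
  (finrank_hom_simple_simple_eq_zero_iff k _ X).2 <| not_nonempty_iff.1 fun e =>
    h ((SimpleClass.of_rep S).symm.trans (SimpleClass.of_eq_of_iff.2 e))

lemma classOf_simple (X : D) [Simple X] :
    classOf k X = Finsupp.single (SimpleClass.of X) 1 := by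
  rw [classOf, finsum_eq_single _ (SimpleClass.of X), multiplicity_self, Nat.cast_one]
  intro S hS
  rw [multiplicity_eq_zero k X hS, Nat.cast_zero, Finsupp.single_zero]

omit [IsAlgClosed k] [HasKernels D] [∀ X Y : D, FiniteDimensional k (X ⟶ Y)] in
lemma classOf_apply [Finite (SimpleClass D)] (X : D) (S : SimpleClass D) :
    classOf k X S = multiplicity k X S := by
  classical
  have := Fintype.ofFinite (SimpleClass D)
  rw [classOf, finsum_eq_sum_of_fintype, Finsupp.finsetSum_apply]
  simp [Finsupp.single_apply]

end Classes

/-- In a semisimple category over an algebraically closed field, an object whose class is that of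
a simple object is isomorphic to it. -/
lemma nonempty_iso_rep_of_classOf (k : Type*) [Field k] [IsAlgClosed k] {D : Type*} [Category* D]
    [Preadditive D] [Linear k D] [IsSemisimpleCategory D]
    [∀ X Y : D, FiniteDimensional k (X ⟶ Y)] [Finite (SimpleClass D)] {X : D} {S : SimpleClass D}
    (h : classOf k X = Finsupp.single S 1) : Nonempty (X ≅ S.rep) := by
  classical
  have hmult (T : SimpleClass D) : (multiplicity k X T : ℤ) = if S = T then 1 else 0 := by
    rw [← classOf_apply, h, Finsupp.single_apply]
  have hS : multiplicity k X S = 1 := by simpa using hmult S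
  obtain ⟨n, U, hU, ⟨e⟩⟩ := IsSemisimpleCategory.exists_decomposition X
  let s (i : Fin n) : U i ⟶ X := biproduct.ι U i ≫ e.inv
  have hs (i : Fin n) : s i ≫ e.hom ≫ biproduct.π U i = 𝟙 _ := by simp [s]
  have hs' (i j : Fin n) (hij : i ≠ j) : s i ≫ e.hom ≫ biproduct.π U j = 0 := by
    simp [s, biproduct.ι_π_ne U hij]
  have hUS (i : Fin n) : Nonempty (S.rep ≅ U i) := by
    have hi := hU i
    rw [← SimpleClass.of_eq_of_iff, SimpleClass.of_rep]
    by_contra hne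
    obtain ⟨r⟩ := SimpleClass.nonempty_rep_of_iso (U i)
    have h0 : multiplicity k X (SimpleClass.of (U i)) = 0 := by
      simpa [hne] using hmult (SimpleClass.of (U i))
    have h1 := Module.finrank_zero_iff.1 h0
    apply id_nonzero (U i)
    rw [← hs i, ← cancel_epi r.hom, ← Category.assoc, Subsingleton.elim (r.hom ≫ s i) 0]
    simp
  obtain _ | _ | n := n
  · exfalso
    have : Subsingleton (S.rep ⟶ X) := ⟨fun f g => by
      rw [← cancel_mono e.hom]
      exact biproduct.hom_ext _ _ fun i => i.elim0⟩
    rw [multiplicity, Module.finrank_zero_of_subsingleton] at hS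
    exact zero_ne_one hS
  · refine ⟨e ≪≫ ⟨biproduct.π U 0, biproduct.ι U 0, ?_, by simp⟩ ≪≫ (hUS 0).some.symm⟩
    rw [← biproduct.total]
    simp
  · exfalso
    -- two distinct summands give linearly independent vectors of the line `Hom(S, X)`
    have h01 : (0 : Fin (n + 1 + 1)) ≠ 1 := by simp
    obtain ⟨r₀⟩ := hUS 0
    obtain ⟨r₁⟩ := hUS 1
    have hr (i : Fin (n + 1 + 1)) (r : S.rep ≅ U i) : r.hom ≫ s i ≠ 0 := by
      intro h
      have hi := hU i
      apply id_nonzero (U i)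
      rw [← hs i, ← cancel_epi r.hom, reassoc_of% h]
      simp
    obtain ⟨c, hc⟩ := (finrank_eq_one_iff_of_nonzero' _ (hr 0 r₀)).1 hS (r₁.hom ≫ s 1)
    have h1 := congrArg (fun t => t ≫ e.hom ≫ biproduct.π U 1) hc
    simp only [Linear.smul_comp, Category.assoc, hs' 0 1 h01, hs 1, comp_zero, smul_zero,
      Category.comp_id] at h1
    have hi := hU 1
    exact id_nonzero (U 1) (by rw [← r₁.inv_hom_id, ← h1, comp_zero])

/-! ### Semisimplicity from an orthogonal family of objects -/

section OrthogonalFamily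

variable {k : Type*} [Field k] {D : Type*} [Category* D] [Preadditive D] [Linear k D]
  [HasFiniteBiproducts D] {J : Type*}

/-- A family of nonzero objects with `Hom(S i, S j) = 0` for `i ≠ j` and `End(S i) = k`, such that
every object is a finite direct sum of members of the family. -/
structure IsOrthogonalFamily (k : Type*) [Field k] {D : Type*} [Category* D] [Preadditive D]
    [Linear k D] [HasFiniteBiproducts D] {J : Type*} (S : J → D) : Prop where
  hom_eq_zero : ∀ i j, i ≠ j → ∀ f : S i ⟶ S j, f = 0
  exists_smul : ∀ i (f : S i ⟶ S i), ∃ c : k, f = c • 𝟙 (S i)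
  id_ne_zero : ∀ i, 𝟙 (S i) ≠ 0
  exists_iso_biproduct : ∀ X : D, ∃ (n : ℕ) (a : Fin n → J),
    Nonempty (X ≅ ⨁ fun i => S (a i))

/-- A linear map over a field has a quasi-inverse. -/
lemma exists_quasiInverse {V W : Type*} [AddCommGroup V] [Module k V] [AddCommGroup W]
    [Module k W] (f : V →ₗ[k] W) : ∃ g : W →ₗ[k] V, ∀ v, f (g (f v)) = f v := by
  obtain ⟨h, hh⟩ := f.rangeRestrict.exists_rightInverse_of_surjective f.range_rangeRestrict
  obtain ⟨g, hg⟩ := LinearMap.exists_extend h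
  refine ⟨g, fun v => ?_⟩
  have h1 : g (f v) = h (f.rangeRestrict v) := LinearMap.congr_fun hg (f.rangeRestrict v)
  rw [h1]
  exact congrArg Subtype.val (LinearMap.congr_fun hh (f.rangeRestrict v))

namespace IsOrthogonalFamily

variable {S : J → D} (hS : IsOrthogonalFamily k S)
include hS

/-- The objects `S j` detect equality of morphisms. -/
lemma hom_ext {X Y : D} {f g : X ⟶ Y} (h : ∀ j (x : S j ⟶ X), x ≫ f = x ≫ g) : f = g := by
  obtain ⟨n, a, ⟨e⟩⟩ := hS.exists_iso_biproduct X
  rw [← cancel_epi e.inv]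
  refine biproduct.hom_ext' _ _ fun i => ?_
  simpa using h (a i) (biproduct.ι (fun i => S (a i)) i ≫ e.inv)

/-- Linear maps on the spaces `Hom(S j, X)`, chosen independently for each `j`, come from a
morphism: the functor `X ↦ (Hom(S j, X))_j` to families of vector spaces is full. -/
lemma exists_hom {X Y : D} (φ : ∀ j, (S j ⟶ X) →ₗ[k] (S j ⟶ Y)) :
    ∃ g : X ⟶ Y, ∀ j (x : S j ⟶ X), x ≫ g = φ j x := by
  classical
  obtain ⟨n, a, ⟨e⟩⟩ := hS.exists_iso_biproduct X
  obtain ⟨s, p, total⟩ : ∃ (s : ∀ i, S (a i) ⟶ X) (p : ∀ i, X ⟶ S (a i)),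
      ∑ i, p i ≫ s i = 𝟙 X := by
    refine ⟨fun i => biproduct.ι (fun i => S (a i)) i ≫ e.inv,
      fun i => e.hom ≫ biproduct.π (fun i => S (a i)) i, ?_⟩
    have h := congrArg (fun t => e.hom ≫ t ≫ e.inv) (biproduct.total (f := fun i => S (a i)))
    simpa only [Preadditive.sum_comp, Preadditive.comp_sum, Category.id_comp, e.hom_inv_id,
      Category.assoc] using h
  refine ⟨∑ i, p i ≫ φ (a i) (s i), fun j x => ?_⟩
  have key (i : Fin n) : x ≫ p i ≫ φ (a i) (s i) = φ j (x ≫ p i ≫ s i) := by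
    by_cases hj : j = a i
    · subst hj
      obtain ⟨c, hc⟩ := hS.exists_smul (a i) (x ≫ p i)
      rw [← Category.assoc, ← Category.assoc, hc]
      simp
    · rw [← Category.assoc, ← Category.assoc, hS.hom_eq_zero _ _ hj (x ≫ p i)]
      simp
  rw [Preadditive.comp_sum, Finset.sum_congr rfl fun i _ => key i, ← map_sum,
    ← Preadditive.comp_sum, total, Category.comp_id]

/-- Every morphism has a quasi-inverse. -/
lemma exists_quasiInverse {X Y : D} (f : X ⟶ Y) : ∃ g : Y ⟶ X, f ≫ g ≫ f = f := by
  choose ψ hψ using fun j => GroupNIM.exists_quasiInverse (Linear.rightComp k (S j) f)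
  obtain ⟨g, hg⟩ := hS.exists_hom ψ
  refine ⟨g, hS.hom_ext fun j x => ?_⟩
  have := hψ j x
  simp only [Linear.rightComp_apply] at this
  rw [← Category.assoc x f, ← Category.assoc (x ≫ f) g, hg, this]

/-- Idempotents split: the image of `e` is assembled from bases of the images of `e` on the spaces
`Hom(S j, X)`. -/
lemma exists_splitting [Finite J] [∀ X Y : D, FiniteDimensional k (X ⟶ Y)] {X : D} (e : X ⟶ X)
    (he : e ≫ e = e) : ∃ (Z : D) (i : Z ⟶ X) (p : X ⟶ Z), i ≫ p = 𝟙 Z ∧ p ≫ i = e := by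
  classical
  have := Fintype.ofFinite J
  let E (j : J) := Linear.rightComp k (S j) e
  let b (j : J) := Module.finBasis k (LinearMap.range (E j))
  let K := Σ j, Fin (Module.finrank k (LinearMap.range (E j)))
  have hb (t : K) : (b t.1 t.2 : S t.1 ⟶ X) ≫ e = b t.1 t.2 := by
    obtain ⟨y, hy⟩ := (b t.1 t.2).2
    rw [← hy]
    simp [E, he]
  let i : (⨁ fun t : K => S t.1) ⟶ X := biproduct.desc fun t => (b t.1 t.2 : S t.1 ⟶ X)
  let φ (j : J) : (S j ⟶ X) →ₗ[k] (S j ⟶ ⨁ fun t : K => S t.1) :=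
    ((b j).constr k fun t => biproduct.ι (fun t : K => S t.1) ⟨j, t⟩) ∘ₗ (E j).rangeRestrict
  obtain ⟨p, hp⟩ := hS.exists_hom φ
  refine ⟨_, i, p, biproduct.hom_ext' _ _ fun t => ?_, hS.hom_ext fun j x => ?_⟩
  · have h1 : (E t.1).rangeRestrict (b t.1 t.2 : S t.1 ⟶ X) = b t.1 t.2 :=
      Subtype.ext (hb t)
    rw [← Category.assoc, biproduct.ι_desc, hp, LinearMap.comp_apply, h1, Module.Basis.constr_basis,
      Category.comp_id]
  · have h2 : Linear.rightComp k (S j) i ∘ₗ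
        ((b j).constr k fun t => biproduct.ι (fun t : K => S t.1) ⟨j, t⟩) =
          (LinearMap.range (E j)).subtype := by
      refine (b j).ext fun t => ?_
      simp [i]
    rw [← Category.assoc, hp]
    exact LinearMap.congr_fun h2 ((E j).rangeRestrict x)

lemma simple (j : J) : Simple (S j) where
  mono_isIso_iff_nonzero {Y} f _ := by
    constructor
    · rintro hf rfl
      exact hS.id_ne_zero j (by rw [← IsIso.inv_hom_id (0 : Y ⟶ S j), comp_zero])
    · intro hf
      obtain ⟨g, hg⟩ := hS.exists_quasiInverse f
      obtain ⟨c, hc⟩ := hS.exists_smul j (g ≫ f)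
      rw [hc, Linear.comp_smul, Category.comp_id] at hg
      have h1 : c = 1 := by
        by_contra h
        have : (c - 1) • f = 0 := by rw [sub_smul, hg, one_smul, sub_self]
        exact (smul_eq_zero.1 this).elim (fun h' => h (sub_eq_zero.1 h')) hf
      rw [h1, one_smul] at hc
      exact ⟨g, by rw [← cancel_mono f, Category.assoc, hc]; simp, hc⟩

lemma hasKernel [Finite J] [∀ X Y : D, FiniteDimensional k (X ⟶ Y)] {X Y : D} (f : X ⟶ Y) :
    HasKernel f := by
  obtain ⟨g, hg⟩ := hS.exists_quasiInverse f
  obtain ⟨Z, i, p, hip, hpi⟩ := hS.exists_splitting (𝟙 X - f ≫ g) (by simp [reassoc_of% hg])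
  have hif : i ≫ f = 0 := by
    rw [← Category.id_comp (i ≫ f), ← hip, Category.assoc, ← Category.assoc p i f, hpi]
    simp [hg]
  exact ⟨⟨_, KernelFork.IsLimit.ofι i hif (fun w _ => w ≫ p)
    (fun w hw => by rw [Category.assoc, hpi]; simp [reassoc_of% hw])
    (fun w _ m hm => by rw [← hm, Category.assoc, hip, Category.comp_id])⟩⟩

lemma hasCokernel [Finite J] [∀ X Y : D, FiniteDimensional k (X ⟶ Y)] {X Y : D} (f : X ⟶ Y) :
    HasCokernel f := by
  obtain ⟨g, hg⟩ := hS.exists_quasiInverse f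
  obtain ⟨Z, i, p, hip, hpi⟩ := hS.exists_splitting (𝟙 Y - g ≫ f) (by simp [hg])
  have hfp : f ≫ p = 0 := by
    rw [← Category.comp_id (f ≫ p), ← hip, Category.assoc, ← Category.assoc p i p, hpi,
      ← Category.assoc]
    simp [hg]
  exact ⟨⟨_, CokernelCofork.IsColimit.ofπ p hfp (fun w _ => i ≫ w)
    (fun w hw => by rw [← Category.assoc, hpi]; simp [hw])
    (fun w _ m hm => by rw [← hm, ← Category.assoc, hip, Category.id_comp])⟩⟩

/-- A category with a finite orthogonal family is semisimple. -/
lemma isSemisimpleCategory [Finite J] [∀ X Y : D, FiniteDimensional k (X ⟶ Y)] :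
    IsSemisimpleCategory D where
  has_limit f := hS.hasKernel f
  has_colimit f := hS.hasCokernel f
  normalMonoOfMono {X Y} f _ := by
    obtain ⟨g, hg⟩ := hS.exists_quasiInverse f
    have hfg : f ≫ g = 𝟙 X := by rw [← cancel_mono f, Category.assoc, hg, Category.id_comp]
    exact ⟨{
      Z := Y
      g := 𝟙 Y - g ≫ f
      w := by simp [hg]
      isLimit := KernelFork.IsLimit.ofι f (by simp [hg]) (fun w _ => w ≫ g)
        (fun w hw => by
          rw [Preadditive.comp_sub, sub_eq_zero, Category.comp_id] at hw
          rw [Category.assoc, ← hw])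
        (fun w _ m hm => by rw [← hm, Category.assoc, hfg, Category.comp_id]) }⟩
  normalEpiOfEpi {X Y} f _ := by
    obtain ⟨g, hg⟩ := hS.exists_quasiInverse f
    have hgf : g ≫ f = 𝟙 Y := by rw [← cancel_epi f, hg, Category.comp_id]
    exact ⟨{
      W := X
      g := 𝟙 X - f ≫ g
      w := by simp [hg]
      isColimit := CokernelCofork.IsColimit.ofπ f (by simp [hg]) (fun w _ => g ≫ w)
        (fun w hw => by
          rw [Preadditive.sub_comp, sub_eq_zero, Category.id_comp] at hw
          rw [← Category.assoc, ← hw])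
        (fun w _ m hm => by rw [← hm, ← Category.assoc, hgf, Category.id_comp]) }⟩
  exists_decomposition X := by
    obtain ⟨n, a, ⟨e⟩⟩ := hS.exists_iso_biproduct X
    exact ⟨n, fun i => S (a i), fun i => hS.simple (a i), ⟨e⟩⟩

/-- The classes of simple objects are those of the members of the family. -/
noncomputable def equivSimpleClass [Finite J] [∀ X Y : D, FiniteDimensional k (X ⟶ Y)] :
    J ≃ SimpleClass D :=
  Equiv.ofBijective (fun j => @SimpleClass.of D _ _ (S j) (hS.simple j)) <| by
    have := hS.isSemisimpleCategory
    refine ⟨fun i j hij => ?_, fun c => ?_⟩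
    · obtain ⟨e⟩ := Quotient.exact hij
      by_contra h
      exact hS.id_ne_zero i (by rw [← e.hom_inv_id, hS.hom_eq_zero i j h e.hom, zero_comp])
    · obtain ⟨⟨X, hX⟩, rfl⟩ := Quotient.exists_rep c
      obtain ⟨n, a, ⟨e⟩⟩ := hS.exists_iso_biproduct X
      obtain ⟨i, hi⟩ : ∃ i, e.hom ≫ biproduct.π (fun i => S (a i)) i ≠ 0 := by
        by_contra! h
        apply id_nonzero X
        rw [← cancel_mono e.hom]
        exact biproduct.hom_ext _ _ fun i => by simp [h i]
      have := hS.simple (a i)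
      have := isIso_of_hom_simple hi
      exact ⟨a i, Quotient.sound ⟨(asIso (e.hom ≫ biproduct.π (fun i => S (a i)) i)).symm⟩⟩

lemma nonempty_rep_iso [Finite J] [∀ X Y : D, FiniteDimensional k (X ⟶ Y)] (j : J) :
    Nonempty ((hS.equivSimpleClass j).rep ≅ S j) :=
  Quotient.exact (Quotient.out_eq (hS.equivSimpleClass j))

end IsOrthogonalFamily

end OrthogonalFamily

/-! ### Graded vector spaces as a category of graded matrices -/

/-- A finite-dimensional `G`-graded vector space over `k` with a homogeneous basis: a finite index
set together with the degrees of the basis vectors. The index sets live in a universe that contains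
both `k` and `G`, so that objects and morphisms lie in consecutive universes. -/
structure GradedVec (k : Type u) (G : Type v) : Type (max u v + 1) where
  /-- the index set of the basis -/
  ι : Type (max u v)
  [fintype : Fintype ι]
  /-- the degrees of the basis vectors -/
  deg : ι → G

namespace GradedVec

attribute [instance] fintype

noncomputable section

variable {k : Type u} [Field k] {G : Type v}

/-- A degree-preserving linear map, as a matrix acting on row vectors. -/
@[ext]
structure Hom (X Y : GradedVec k G) where
  /-- the matrix -/
  mat : Matrix X.ι Y.ι k
  supp : ∀ i j, X.deg i ≠ Y.deg j → mat i j = 0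

open scoped Classical in
/-- The matrix of a degree-preserving map of index sets. -/
@[simps]
def Hom.ofMap {X Y : GradedVec k G} (f : X.ι → Y.ι) (hf : ∀ i, Y.deg (f i) = X.deg i) :
    Hom X Y where
  mat i j := if f i = j then 1 else 0
  supp i j h := if_neg fun e => h (by rw [← e, hf])

instance : Category (GradedVec k G) where
  Hom := Hom
  id X := Hom.ofMap id fun _ => rfl
  comp {X Y Z} f g := ⟨f.mat * g.mat, fun i j h => by
    rw [Matrix.mul_apply]
    refine Finset.sum_eq_zero fun x _ => ?_
    by_cases hx : X.deg i = Y.deg x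
    · rw [g.supp x j (hx ▸ h), mul_zero]
    · rw [f.supp i x hx, zero_mul]⟩
  id_comp f := by
    classical
    ext i j
    simp [Matrix.mul_apply]
  comp_id f := by
    classical
    ext i j
    simp [Matrix.mul_apply]
  assoc f g h := Hom.ext (Matrix.mul_assoc _ _ _)

variable {X Y Z : GradedVec k G}

@[ext]
lemma hom_ext {f g : X ⟶ Y} (h : ∀ i j, f.mat i j = g.mat i j) : f = g :=
  Hom.ext (Matrix.ext h)

lemma mat_eq_zero (f : X ⟶ Y) {i : X.ι} {j : Y.ι} (h : X.deg i ≠ Y.deg j) : f.mat i j = 0 :=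
  f.supp i j h

lemma comp_mat (f : X ⟶ Y) (g : Y ⟶ Z) (i : X.ι) (j : Z.ι) :
    (f ≫ g).mat i j = ∑ x, f.mat i x * g.mat x j := rfl

open scoped Classical in
lemma id_mat (i j : X.ι) : (𝟙 X : X ⟶ X).mat i j = if i = j then 1 else 0 := rfl

/-- The morphism that permutes basis vectors along a degree-preserving map of index sets. -/
def ofMap (f : X.ι → Y.ι) (hf : ∀ i, Y.deg (f i) = X.deg i) : X ⟶ Y := Hom.ofMap f hf

open scoped Classical in
lemma ofMap_mat (f : X.ι → Y.ι) (hf : ∀ i, Y.deg (f i) = X.deg i) (i : X.ι) (j : Y.ι) :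
    (ofMap f hf).mat i j = if f i = j then 1 else 0 := rfl

lemma ofMap_id : ofMap (X := X) id (fun _ => rfl) = 𝟙 X := rfl

lemma ofMap_comp_mat (f : X.ι → Y.ι) (hf : ∀ i, Y.deg (f i) = X.deg i) (g : Y ⟶ Z) (i : X.ι)
    (j : Z.ι) : (ofMap f hf ≫ g).mat i j = g.mat (f i) j := by
  classical
  simp [comp_mat, ofMap_mat]

lemma comp_ofMap_mat (f : X ⟶ Y) (e : Y.ι ≃ Z.ι) (he : ∀ i, Z.deg (e i) = Y.deg i) (i : X.ι)
    (j : Z.ι) : (f ≫ ofMap e he).mat i j = f.mat i (e.symm j) := by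
  classical
  simp only [comp_mat, ofMap_mat, ← Equiv.eq_symm_apply]
  simp

lemma ofMap_comp_ofMap (f : X.ι → Y.ι) (hf : ∀ i, Y.deg (f i) = X.deg i) (g : Y.ι → Z.ι)
    (hg : ∀ i, Z.deg (g i) = Y.deg i) :
    ofMap f hf ≫ ofMap g hg = ofMap (g ∘ f) fun i => (hg _).trans (hf i) := by
  ext i j
  rw [ofMap_comp_mat]
  rfl

lemma ofMap_congr {f g : X.ι → Y.ι} (hf : ∀ i, Y.deg (f i) = X.deg i) (h : f = g) :
    ofMap f hf = ofMap g (h ▸ hf) := by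
  subst h
  rfl

omit [Field k] in
lemma deg_symm_apply (e : X.ι ≃ Y.ι) (he : ∀ i, Y.deg (e i) = X.deg i) (j : Y.ι) :
    X.deg (e.symm j) = Y.deg j := by
  rw [← he, e.apply_symm_apply]

/-- The isomorphism given by a degree-preserving bijection of index sets. -/
@[simps]
def isoOfEquiv (e : X.ι ≃ Y.ι) (he : ∀ i, Y.deg (e i) = X.deg i) : X ≅ Y where
  hom := ofMap e he
  inv := ofMap e.symm (deg_symm_apply e he)
  hom_inv_id := by
    rw [ofMap_comp_ofMap, ← ofMap_id]
    exact ofMap_congr _ (funext e.symm_apply_apply)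
  inv_hom_id := by
    rw [ofMap_comp_ofMap, ← ofMap_id]
    exact ofMap_congr _ (funext e.apply_symm_apply)

/-! ### The linear structure and direct sums -/

instance : Zero (X ⟶ Y) := ⟨⟨0, fun _ _ _ => rfl⟩⟩
instance : Add (X ⟶ Y) :=
  ⟨fun f g => ⟨f.mat + g.mat, fun i j h => by simp [f.supp i j h, g.supp i j h]⟩⟩
instance : Neg (X ⟶ Y) := ⟨fun f => ⟨-f.mat, fun i j h => by simp [f.supp i j h]⟩⟩
instance : SMul k (X ⟶ Y) := ⟨fun c f => ⟨c • f.mat, fun i j h => by simp [f.supp i j h]⟩⟩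

@[simp] lemma zero_mat : (0 : X ⟶ Y).mat = 0 := rfl
@[simp] lemma add_mat (f g : X ⟶ Y) : (f + g).mat = f.mat + g.mat := rfl
@[simp] lemma smul_mat (c : k) (f : X ⟶ Y) : (c • f).mat = c • f.mat := rfl

instance : AddCommGroup (X ⟶ Y) where
  add_assoc _ _ _ := Hom.ext (add_assoc _ _ _)
  zero_add _ := Hom.ext (zero_add _)
  add_zero _ := Hom.ext (add_zero _)
  add_comm _ _ := Hom.ext (add_comm _ _)
  neg_add_cancel _ := Hom.ext (neg_add_cancel _)
  nsmul := nsmulRec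
  zsmul := zsmulRec

instance : Preadditive (GradedVec k G) where
  add_comp _ _ _ f f' g := Hom.ext (Matrix.add_mul f.mat f'.mat g.mat)
  comp_add _ _ _ f g g' := Hom.ext (Matrix.mul_add f.mat g.mat g'.mat)

instance : Linear k (GradedVec k G) where
  homModule _ _ :=
    { one_smul := fun _ => Hom.ext (one_smul k _)
      mul_smul := fun _ _ _ => Hom.ext (mul_smul _ _ _)
      smul_zero := fun _ => Hom.ext (smul_zero _)
      smul_add := fun _ _ _ => Hom.ext (smul_add _ _ _)
      add_smul := fun _ _ _ => Hom.ext (add_smul _ _ _)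
      zero_smul := fun _ => Hom.ext (zero_smul k _) }
  smul_comp _ _ _ c f g := Hom.ext (Matrix.smul_mul c f.mat g.mat)
  comp_smul _ _ _ f c g := Hom.ext (Matrix.mul_smul f.mat c g.mat)

/-- The matrix of a morphism, as a linear map. -/
@[simps]
def matLinear (X Y : GradedVec k G) : (X ⟶ Y) →ₗ[k] Matrix X.ι Y.ι k where
  toFun := Hom.mat
  map_add' _ _ := rfl
  map_smul' _ _ := rfl

lemma sum_mat {α : Type*} (s : Finset α) (f : α → (X ⟶ Y)) (i : X.ι) (j : Y.ι) :
    (∑ a ∈ s, f a).mat i j = ∑ a ∈ s, (f a).mat i j := by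
  have h := map_sum (matLinear X Y) f s
  simp only [matLinear_apply] at h
  rw [h, Matrix.sum_apply]

instance (X Y : GradedVec k G) : FiniteDimensional k (X ⟶ Y) :=
  FiniteDimensional.of_injective (matLinear X Y) fun _ _ h => Hom.ext h

open scoped Classical in
/-- The transpose of `ofMap f`. -/
def ofMapTranspose (f : X.ι → Y.ι) (hf : ∀ i, Y.deg (f i) = X.deg i) : Y ⟶ X :=
  ⟨fun j i => if f i = j then 1 else 0, fun j i h => if_neg fun e => h (by rw [← e, hf])⟩

open scoped Classical in
lemma ofMapTranspose_mat (f : X.ι → Y.ι) (hf : ∀ i, Y.deg (f i) = X.deg i) (i : X.ι) (j : Y.ι) :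
    (ofMapTranspose f hf).mat j i = if f i = j then 1 else 0 := rfl

/-- Degree-preserving maps that are jointly a bijection `Σ a, F a ≃ X` of index sets exhibit `X` as
a direct sum. -/
def bicone {α : Type} (F : α → GradedVec k G) (X : GradedVec k G)
    (e : (Σ a, (F a).ι) ≃ X.ι) (he : ∀ a x, X.deg (e ⟨a, x⟩) = (F a).deg x) : Bicone F where
  pt := X
  ι a := ofMap (fun x => e ⟨a, x⟩) (he a)
  π a := ofMapTranspose (fun x => e ⟨a, x⟩) (he a)
  ι_π a b := by
    classical
    split_ifs with h
    · subst h
      ext i j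
      simp [ofMap_comp_mat, ofMapTranspose_mat, id_mat, eq_comm]
    · ext i j
      simp [ofMap_comp_mat, ofMapTranspose_mat, Ne.symm h]

/-- The bicone of a bijection `Σ a, F a ≃ X` is a biproduct. -/
def biconeIsBilimit {α : Type} [Fintype α] (F : α → GradedVec k G) (X : GradedVec k G)
    (e : (Σ a, (F a).ι) ≃ X.ι) (he : ∀ a x, X.deg (e ⟨a, x⟩) = (F a).deg x) :
    (bicone F X e he).IsBilimit :=
  isBilimitOfTotal _ <| by
    classical
    have h : ∑ a, ofMapTranspose (fun x => e ⟨a, x⟩) (he a) ≫ ofMap (fun x => e ⟨a, x⟩) (he a) =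
        𝟙 X := by
      ext i j
      obtain ⟨⟨a, x⟩, rfl⟩ := e.surjective i
      simp only [sum_mat, comp_mat, ofMapTranspose_mat, ofMap_mat, id_mat]
      rw [Fintype.sum_eq_single a, Fintype.sum_eq_single x]
      · simp
      · intro y hy
        simp [hy]
      · intro b hb
        exact Finset.sum_eq_zero fun y _ => by simp [hb]
    exact h

instance : HasFiniteBiproducts (GradedVec k G) where
  out _ := ⟨fun F => ⟨⟨⟨_, biconeIsBilimit F
    ⟨Σ a, (F a).ι, fun s => (F s.1).deg s.2⟩ (Equiv.refl _) fun _ _ => rfl⟩⟩⟩⟩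

/-- The line in degree `g`. -/
abbrev line (k : Type u) {G : Type v} (g : G) : GradedVec k G := ⟨PUnit, fun _ => g⟩

lemma line_id_mat (g : G) : (𝟙 (line k g) : line k g ⟶ line k g).mat PUnit.unit PUnit.unit = 1 :=
  if_pos rfl

/-- The lines are an orthogonal family: a graded vector space is the direct sum of the lines
spanned by its homogeneous basis vectors. -/
lemma isOrthogonalFamily_line : IsOrthogonalFamily k (line k : G → GradedVec k G) where
  hom_eq_zero g h hgh f := by
    ext i j
    exact mat_eq_zero f hgh
  exists_smul g f := ⟨f.mat PUnit.unit PUnit.unit, by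
    ext ⟨⟩ ⟨⟩
    change _ = f.mat _ _ * (𝟙 (line k g) : line k g ⟶ line k g).mat PUnit.unit PUnit.unit
    rw [line_id_mat, mul_one]⟩
  id_ne_zero g h := by
    apply one_ne_zero (α := k)
    rw [← line_id_mat g, h]
    rfl
  exists_iso_biproduct X := by
    classical
    let e := Fintype.equivFin X.ι
    exact ⟨Fintype.card X.ι, fun i => X.deg (e.symm i), ⟨biproduct.uniqueUpToIso _
      (biconeIsBilimit (fun i => line k (X.deg (e.symm i))) X
        ((Equiv.sigmaPUnit _).trans e.symm) fun _ _ => rfl)⟩⟩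

end

end GradedVec

namespace GradedVec

/-! ### Tensor products and duals of graded vector spaces -/

noncomputable section

variable {k : Type u} [Field k] {G : Type v} [Group G]

/-- The tensor product of graded vector spaces, with the product basis. -/
abbrev tensor (X Y : GradedVec k G) : GradedVec k G := ⟨X.ι × Y.ι, fun p => X.deg p.1 * Y.deg p.2⟩

/-- The tensor product of degree-preserving maps: the Kronecker product of their matrices. -/
def tensorMap {X Y X' Y' : GradedVec k G} (f : X ⟶ Y) (g : X' ⟶ Y') : tensor X X' ⟶ tensor Y Y' :=
  ⟨fun p q => f.mat p.1 q.1 * g.mat p.2 q.2, fun p q h => by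
    by_cases h1 : X.deg p.1 = Y.deg q.1
    · rw [mat_eq_zero g fun h2 => h (congrArg₂ _ h1 h2), mul_zero]
    · rw [mat_eq_zero f h1, zero_mul]⟩

omit [Field k] in
lemma deg_prodMap {X Y X' Y' : GradedVec k G} {f : X.ι → Y.ι} (hf : ∀ i, Y.deg (f i) = X.deg i)
    {g : X'.ι → Y'.ι} (hg : ∀ i, Y'.deg (g i) = X'.deg i) (p : (tensor X X').ι) :
    (tensor Y Y').deg (Prod.map f g p) = (tensor X X').deg p := congrArg₂ _ (hf p.1) (hg p.2)

omit [Field k] in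
lemma deg_prodAssoc (X Y Z : GradedVec k G) (p : (tensor (tensor X Y) Z).ι) :
    (tensor X (tensor Y Z)).deg (Equiv.prodAssoc X.ι Y.ι Z.ι p) = (tensor (tensor X Y) Z).deg p :=
  (mul_assoc _ _ _).symm

omit [Field k] in
lemma deg_punitProd (X : GradedVec k G) (p : (tensor (line k 1) X).ι) :
    X.deg (Equiv.punitProd X.ι p) = (tensor (line k 1) X).deg p := (one_mul _).symm

omit [Field k] in
lemma deg_prodPUnit (X : GradedVec k G) (p : (tensor X (line k 1)).ι) :
    X.deg (Equiv.prodPUnit X.ι p) = (tensor X (line k 1)).deg p := (mul_one _).symm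

/-- The associativity isomorphism. -/
abbrev assocIso (X Y Z : GradedVec k G) : tensor (tensor X Y) Z ≅ tensor X (tensor Y Z) :=
  isoOfEquiv (Equiv.prodAssoc X.ι Y.ι Z.ι) (deg_prodAssoc X Y Z)

/-- The left unit isomorphism. -/
abbrev leftUnitIso (X : GradedVec k G) : tensor (line k 1) X ≅ X :=
  isoOfEquiv (Equiv.punitProd X.ι) (deg_punitProd X)

/-- The right unit isomorphism. -/
abbrev rightUnitIso (X : GradedVec k G) : tensor X (line k 1) ≅ X :=
  isoOfEquiv (Equiv.prodPUnit X.ι) (deg_prodPUnit X)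

variable {X Y Z X' Y' Z' X'' Y'' : GradedVec k G}

lemma tensorMap_mat (f : X ⟶ Y) (g : X' ⟶ Y') (p : X.ι × X'.ι) (q : Y.ι × Y'.ι) :
    (tensorMap f g).mat p q = f.mat p.1 q.1 * g.mat p.2 q.2 := rfl

lemma tensorMap_ofMap (f : X.ι → Y.ι) (hf : ∀ i, Y.deg (f i) = X.deg i) (g : X'.ι → Y'.ι)
    (hg : ∀ i, Y'.deg (g i) = X'.deg i) :
    tensorMap (ofMap f hf) (ofMap g hg) =
      ofMap (X := tensor X X') (Y := tensor Y Y') (Prod.map f g) (deg_prodMap hf hg) := by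
  classical
  ext ⟨i, i'⟩ ⟨j, j'⟩
  by_cases h : f i = j <;> simp [tensorMap_mat, ofMap_mat, h]

lemma tensorMap_id : tensorMap (𝟙 X) (𝟙 X') = 𝟙 (tensor X X') :=
  tensorMap_ofMap (X := X) (X' := X') id (fun _ => rfl) id fun _ => rfl

lemma tensorMap_comp_tensorMap (f : X ⟶ Y) (g : X' ⟶ Y') (f' : Y ⟶ Z) (g' : Y' ⟶ Z') :
    tensorMap f g ≫ tensorMap f' g' = tensorMap (f ≫ f') (g ≫ g') := by
  ext ⟨i, i'⟩ ⟨j, j'⟩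
  simp only [comp_mat, tensorMap_mat, Finset.sum_mul_sum]
  refine (Fintype.sum_prod_type _).trans ?_
  exact Finset.sum_congr rfl fun x _ => Finset.sum_congr rfl fun y _ => mul_mul_mul_comm _ _ _ _

lemma assocIso_naturality (f : X ⟶ Y) (g : X' ⟶ Y') (h : X'' ⟶ Y'') :
    tensorMap (tensorMap f g) h ≫ (assocIso Y Y' Y'').hom =
      (assocIso X X' X'').hom ≫ tensorMap f (tensorMap g h) := by
  ext ⟨⟨i, i'⟩, i''⟩ ⟨j, j', j''⟩
  refine (comp_ofMap_mat (Z := tensor Y (tensor Y' Y'')) (tensorMap (tensorMap f g) h)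
    (Equiv.prodAssoc Y.ι Y'.ι Y''.ι) (deg_prodAssoc Y Y' Y'') _ _).trans
    (Eq.trans ?_ (ofMap_comp_mat _ (deg_prodAssoc X X' X'')
      (tensorMap f (tensorMap g h)) _ _).symm)
  exact mul_assoc (f.mat i j) (g.mat i' j') (h.mat i'' j'')

lemma leftUnitIso_naturality (f : X ⟶ Y) :
    tensorMap (𝟙 _) f ≫ (leftUnitIso Y).hom = (leftUnitIso X).hom ≫ f := by
  ext ⟨⟨⟩, i⟩ j
  refine (comp_ofMap_mat (tensorMap (𝟙 (line k 1)) f) (Equiv.punitProd Y.ι) (deg_punitProd Y)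
    _ _).trans (Eq.trans ?_ (ofMap_comp_mat _ (deg_punitProd X) f _ _).symm)
  exact (congrArg (· * f.mat i j) (line_id_mat 1)).trans (one_mul _)

lemma rightUnitIso_naturality (f : X ⟶ Y) :
    tensorMap f (𝟙 _) ≫ (rightUnitIso Y).hom = (rightUnitIso X).hom ≫ f := by
  ext ⟨i, ⟨⟩⟩ j
  refine (comp_ofMap_mat (tensorMap f (𝟙 (line k 1))) (Equiv.prodPUnit Y.ι) (deg_prodPUnit Y)
    _ _).trans (Eq.trans ?_ (ofMap_comp_mat _ (deg_prodPUnit X) f _ _).symm)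
  exact (congrArg (f.mat i j * ·) (line_id_mat 1)).trans (mul_one _)

lemma assocIso_pentagon (W X Y Z : GradedVec k G) :
    tensorMap (assocIso W X Y).hom (𝟙 Z) ≫ (assocIso W (tensor X Y) Z).hom ≫
      tensorMap (𝟙 W) (assocIso X Y Z).hom =
    (assocIso (tensor W X) Y Z).hom ≫ (assocIso W X (tensor Y Z)).hom := by
  simp only [isoOfEquiv_hom, ← ofMap_id, tensorMap_ofMap, ofMap_comp_ofMap]
  rfl

lemma assocIso_triangle (X Y : GradedVec k G) :
    (assocIso X (line k 1) Y).hom ≫ tensorMap (𝟙 X) (leftUnitIso Y).hom =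
      tensorMap (rightUnitIso X).hom (𝟙 Y) := by
  simp only [isoOfEquiv_hom, ← ofMap_id, tensorMap_ofMap, ofMap_comp_ofMap]
  rfl

instance : MonoidalCategoryStruct (GradedVec k G) where
  tensorObj X Y := tensor X Y
  tensorHom f g := tensorMap f g
  whiskerLeft X _ _ f := tensorMap (𝟙 X) f
  whiskerRight f Y := tensorMap f (𝟙 Y)
  tensorUnit := line k 1
  associator := assocIso
  leftUnitor := leftUnitIso
  rightUnitor := rightUnitIso

instance : MonoidalCategory (GradedVec k G) := MonoidalCategory.ofTensorHom
  (id_tensorHom_id := fun _ _ => tensorMap_id)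
  (id_tensorHom := fun _ _ _ _ => rfl)
  (tensorHom_id := fun _ _ => rfl)
  (tensorHom_comp_tensorHom := tensorMap_comp_tensorMap)
  (associator_naturality := assocIso_naturality)
  (leftUnitor_naturality := leftUnitIso_naturality)
  (rightUnitor_naturality := rightUnitIso_naturality)
  (pentagon := assocIso_pentagon)
  (triangle := assocIso_triangle)

instance : MonoidalPreadditive (GradedVec k G) where
  whiskerLeft_zero := Hom.ext <| Matrix.ext fun _ _ => mul_zero _
  zero_whiskerRight := Hom.ext <| Matrix.ext fun _ _ => zero_mul _
  whiskerLeft_add _ _ := Hom.ext <| Matrix.ext fun _ _ => mul_add _ _ _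
  add_whiskerRight _ _ := Hom.ext <| Matrix.ext fun _ _ => add_mul _ _ _

instance : MonoidalLinear k (GradedVec k G) where
  whiskerLeft_smul _ _ _ _ _ := Hom.ext <| Matrix.ext fun _ _ => mul_left_comm _ _ _
  smul_whiskerRight _ _ _ _ _ := Hom.ext <| Matrix.ext fun _ _ => mul_assoc _ _ _

open scoped Classical in
/-- The pairing of `X` and `Y` along a bijection of their index sets that inverts degrees. -/
def pairing (e : X.ι ≃ Y.ι) (he : ∀ i, X.deg i * Y.deg (e i) = 1) : tensor X Y ⟶ line k 1 :=
  ⟨fun p _ => if e p.1 = p.2 then 1 else 0, fun _ _ h => if_neg fun h' => h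
    ((congrArg (_ * Y.deg ·) h').symm.trans (he _))⟩

open scoped Classical in
/-- The copairing of `X` and `Y` along a bijection of their index sets that inverts degrees. -/
def copairing (e : X.ι ≃ Y.ι) (he : ∀ i, X.deg i * Y.deg (e i) = 1) : line k 1 ⟶ tensor X Y :=
  ⟨fun _ p => if e p.1 = p.2 then 1 else 0, fun _ _ h => if_neg fun h' => h
    ((congrArg (_ * Y.deg ·) h').symm.trans (he _)).symm⟩

open scoped Classical in
lemma pairing_mat (e : X.ι ≃ Y.ι) (he : ∀ i, X.deg i * Y.deg (e i) = 1) (i : X.ι) (j : Y.ι)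
    (x : PUnit) : (pairing e he).mat (i, j) x = if e i = j then 1 else 0 := rfl

open scoped Classical in
lemma copairing_mat (e : X.ι ≃ Y.ι) (he : ∀ i, X.deg i * Y.deg (e i) = 1) (i : X.ι) (j : Y.ι)
    (x : PUnit) : (copairing e he).mat x (i, j) = if e i = j then 1 else 0 := rfl

/-- One of the two triangle identities of a dual pair; the other is `pairing_copairing`. -/
lemma copairing_pairing (e : X.ι ≃ Y.ι) (he : ∀ i, X.deg i * Y.deg (e i) = 1)
    (he' : ∀ i, Y.deg i * X.deg (e.symm i) = 1) :
    tensorMap (𝟙 Y) (copairing e he) ≫ (assocIso Y X Y).inv ≫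
        tensorMap (pairing e.symm he') (𝟙 Y) =
      (rightUnitIso Y).hom ≫ (leftUnitIso Y).inv := by
  classical
  ext ⟨i, ⟨⟩⟩ ⟨⟨⟩, j⟩
  have h₁ (p : Y.ι × X.ι × Y.ι) : (tensorMap (𝟙 Y) (copairing e he)).mat (i, PUnit.unit) p =
      (if i = p.1 then 1 else 0) * if e p.2.1 = p.2.2 then 1 else 0 := by
    rw [tensorMap_mat, id_mat, copairing_mat]
  have h₂ (p : Y.ι × X.ι × Y.ι) : ((assocIso Y X Y).inv ≫
      tensorMap (pairing e.symm he') (𝟙 Y)).mat p (PUnit.unit, j) =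
        (if e.symm p.1 = p.2.1 then 1 else 0) * if p.2.2 = j then 1 else 0 := by
    refine (ofMap_comp_mat _ (deg_symm_apply _ (deg_prodAssoc Y X Y)) _ _ _).trans ?_
    rw [tensorMap_mat, id_mat, Equiv.prodAssoc_symm_apply, pairing_mat]
  have h₃ : ((rightUnitIso Y).hom ≫ (leftUnitIso Y).inv).mat (i, PUnit.unit) (PUnit.unit, j) =
      if i = j then 1 else 0 := by
    refine (ofMap_comp_mat _ (deg_prodPUnit Y) _ _ _).trans
      ((ofMap_mat _ (deg_symm_apply _ (deg_punitProd Y)) _ _).trans ?_)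
    simp
  refine Eq.trans ?_ h₃.symm
  refine (Finset.sum_congr rfl fun p _ => congrArg₂ (· * ·) (h₁ p) (h₂ p)).trans ?_
  refine (Fintype.sum_eq_single (i, e.symm i, i) ?_).trans (by simp)
  rintro ⟨a, b, c⟩ h
  by_cases hi : i = a
  · subst hi
    by_cases hb : e.symm i = b
    · subst hb
      have hc : i ≠ c := fun hc => h (by rw [hc])
      simp [hc]
    · simp [hb]
  · simp [hi]

lemma pairing_copairing (e : X.ι ≃ Y.ι) (he : ∀ i, X.deg i * Y.deg (e i) = 1)
    (he' : ∀ i, Y.deg i * X.deg (e.symm i) = 1) :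
    tensorMap (copairing e he) (𝟙 X) ≫ (assocIso X Y X).hom ≫
        tensorMap (𝟙 X) (pairing e.symm he') =
      (leftUnitIso X).hom ≫ (rightUnitIso X).inv := by
  classical
  ext ⟨⟨⟩, i⟩ ⟨j, ⟨⟩⟩
  have h₁ (p : (X.ι × Y.ι) × X.ι) : (tensorMap (copairing e he) (𝟙 X)).mat (PUnit.unit, i) p =
      (if e p.1.1 = p.1.2 then 1 else 0) * if i = p.2 then 1 else 0 := by
    rw [tensorMap_mat, id_mat, copairing_mat]
  have h₂ (p : (X.ι × Y.ι) × X.ι) : ((assocIso X Y X).hom ≫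
      tensorMap (𝟙 X) (pairing e.symm he')).mat p (j, PUnit.unit) =
        (if p.1.1 = j then 1 else 0) * if e.symm p.1.2 = p.2 then 1 else 0 := by
    refine (ofMap_comp_mat _ (deg_prodAssoc X Y X) _ _ _).trans ?_
    rw [tensorMap_mat, id_mat, Equiv.prodAssoc_apply, pairing_mat]
  have h₃ : ((leftUnitIso X).hom ≫ (rightUnitIso X).inv).mat (PUnit.unit, i) (j, PUnit.unit) =
      if i = j then 1 else 0 := by
    refine (ofMap_comp_mat _ (deg_punitProd X) _ _ _).trans
      ((ofMap_mat _ (deg_symm_apply _ (deg_prodPUnit X)) _ _).trans ?_)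
    simp
  refine Eq.trans ?_ h₃.symm
  refine (Finset.sum_congr rfl fun p _ => congrArg₂ (· * ·) (h₁ p) (h₂ p)).trans ?_
  refine (Fintype.sum_eq_single ((i, e i), i) ?_).trans (by simp)
  rintro ⟨⟨a, b⟩, c⟩ h
  by_cases hi : i = c
  · subst hi
    by_cases hb : e a = b
    · subst hb
      have ha : a ≠ i := fun ha => h (by rw [ha])
      simp [ha]
    · simp [hb]
  · simp [hi]

/-- `X` and `Y` are dual to each other if there is a bijection of their index sets that inverts
degrees. -/
@[reducible]
def exactPairing (e : X.ι ≃ Y.ι) (he : ∀ i, X.deg i * Y.deg (e i) = 1) : ExactPairing X Y where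
  coevaluation' := copairing e he
  evaluation' := pairing e.symm fun i => by
    rw [mul_eq_one_comm]
    simpa using he (e.symm i)
  coevaluation_evaluation' := copairing_pairing e he _
  evaluation_coevaluation' := pairing_copairing e he _

/-- The dual graded vector space, with the dual basis in the inverse degrees. -/
abbrev dual (X : GradedVec k G) : GradedVec k G := ⟨X.ι, fun i => (X.deg i)⁻¹⟩

instance : RigidCategory (GradedVec k G) where
  rightDual X :=
    { rightDual := dual X
      exact := exactPairing (Equiv.refl _) fun _ => mul_inv_cancel _ }
  leftDual X :=
    { leftDual := dual X
      exact := exactPairing (Equiv.refl _) fun _ => inv_mul_cancel _ }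

instance [Finite G] : IsSemisimpleCategory (GradedVec k G) :=
  isOrthogonalFamily_line.isSemisimpleCategory

instance [Finite G] : IsFusionCategory k (GradedVec k G) where
  finite_hom _ _ := inferInstance
  finite_simples := Finite.of_equiv _ isOrthogonalFamily_line.equivSimpleClass
  simple_unit := isOrthogonalFamily_line.simple 1
  rigid := ⟨inferInstance⟩

end

end GradedVec

/-! ### Categories of right modules -/

namespace RightMod

section

variable {C : Type w₂} [Category.{w₁} C] [MonoidalCategory C] {A : C} [MonObj A]

/-- The morphism of right modules `X ⊗ A ⟶ M` induced by a morphism `X ⟶ M`. -/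
@[simps]
def ofHom {X : C} {M : RightMod A} (f : X ⟶ M.X) : tensorObj X (regular A) ⟶ M where
  hom := f ▷ A ≫ M.act
  act_hom := by
    change ((α_ X A A).hom ≫ X ◁ MonObj.mul) ≫ f ▷ A ≫ M.act = (f ▷ A ≫ M.act) ▷ A ≫ M.act
    rw [comp_whiskerRight, Category.assoc, Category.assoc, M.act_assoc]
    simp [whisker_exchange_assoc]

variable [Preadditive C] [MonoidalPreadditive C]

lemma sum_hom {α : Type*} (s : Finset α) {M N : RightMod A} (f : α → (M ⟶ N)) :
    (∑ a ∈ s, f a).hom = ∑ a ∈ s, (f a).hom :=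
  map_sum (AddMonoidHom.mk' (fun g : M ⟶ N => g.hom) fun _ _ => rfl) f s

instance [HasFiniteBiproducts C] : HasFiniteBiproducts (RightMod A) where
  out n := ⟨fun F => by
    let X : RightMod A :=
      { X := ⨁ fun i => (F i).X
        act := biproduct.lift fun i => biproduct.π (fun i => (F i).X) i ▷ A ≫ (F i).act
        act_one := biproduct.hom_ext _ _ fun i => by
          simp [whisker_exchange_assoc, (F i).act_one]
        act_assoc := biproduct.hom_ext _ _ fun i => by
          have h := (F i).act_assoc
          simp only [Category.assoc, biproduct.lift_π]
          rw [← comp_whiskerRight_assoc, biproduct.lift_π, comp_whiskerRight_assoc, h]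
          simp [whisker_exchange_assoc] }
    let b : Bicone F :=
      { pt := X
        π i := ⟨biproduct.π (fun i => (F i).X) i, by simp [X]⟩
        ι i := ⟨biproduct.ι (fun i => (F i).X) i, biproduct.hom_ext _ _ fun j => by
          by_cases h : i = j
          · subst h
            simp [X, ← comp_whiskerRight_assoc]
          · simp [X, ← comp_whiskerRight_assoc, biproduct.ι_π_ne _ h]⟩
        ι_π i j := by
          ext
          by_cases h : i = j
          · subst h
            simp
          · simp [h, biproduct.ι_π_ne _ h] }
    exact hasBiproduct_of_total b (RightMod.hom_ext ((sum_hom _ _).trans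
      (biproduct.total (f := fun i => (F i).X))))⟩

variable (A) in
/-- The functor `X ↦ X ⊗ A` to right modules. -/
@[simps]
def free : C ⥤ RightMod A where
  obj X := tensorObj X (regular A)
  map f := ⟨f ▷ A, tensorLeft_compat f (regular A)⟩

instance : (free A).Additive where
  map_add := by
    intros
    ext
    exact MonoidalPreadditive.add_whiskerRight _ _

variable {k : Type u} [Field k] [Linear k C] [MonoidalLinear k C]

instance [∀ X Y : C, FiniteDimensional k (X ⟶ Y)] (M N : RightMod A) :
    FiniteDimensional k (M ⟶ N) :=
  FiniteDimensional.of_injective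
    (⟨⟨fun f => f.hom, fun _ _ => rfl⟩, fun _ _ => rfl⟩ : (M ⟶ N) →ₗ[k] (M.X ⟶ N.X))
    fun _ _ h => hom_ext h

end

end RightMod

/-! ### The group algebra of a subgroup and its modules -/

namespace GradedVec

open RightMod

noncomputable section

variable {k : Type u} [Field k] {G : Type v} [Group G] [Finite G]

/-- A subgroup of a finite group is a finite type. -/
abbrev subgroupFintype (H : Subgroup G) : Fintype H := Fintype.ofFinite H

attribute [local instance] subgroupFintype

/-- The group algebra of `H`, graded by `G`, with basis `H`. -/
abbrev groupAlgebra (k : Type u) {G : Type v} [Group G] [Finite G] (H : Subgroup G) :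
    GradedVec k G := ⟨ULift.{u} H, fun h => h.down⟩

variable {H : Subgroup G}

omit [Field k] in
lemma deg_mul (p : (tensor (groupAlgebra k H) (groupAlgebra k H)).ι) :
    (groupAlgebra k H).deg (p.1 * p.2) = (tensor (groupAlgebra k H) (groupAlgebra k H)).deg p := rfl

omit [Field k] in
lemma deg_one (x : (line k (1 : G)).ι) :
    (groupAlgebra k H).deg 1 = (line k (1 : G)).deg x := rfl

/-- The multiplication of the group algebra. -/
def algMul (k : Type u) [Field k] (H : Subgroup G) :
    tensor (groupAlgebra k H) (groupAlgebra k H) ⟶ groupAlgebra k H :=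
  ofMap (fun p => p.1 * p.2) deg_mul

/-- The unit of the group algebra. -/
def algOne (k : Type u) [Field k] (H : Subgroup G) : line k (1 : G) ⟶ groupAlgebra k H :=
  ofMap (fun _ => 1) deg_one

instance : MonObj (groupAlgebra k H) where
  one := algOne k H
  mul := algMul k H
  one_mul := by
    change tensorMap (algOne k H) (𝟙 _) ≫ algMul k H = (leftUnitIso _).hom
    simp only [algOne, algMul, isoOfEquiv_hom, ← ofMap_id, tensorMap_ofMap, ofMap_comp_ofMap]
    exact ofMap_congr (X := tensor (line k 1) (groupAlgebra k H)) (Y := groupAlgebra k H) _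
      (funext fun ⟨_, x⟩ => _root_.one_mul x)
  mul_one := by
    change tensorMap (𝟙 _) (algOne k H) ≫ algMul k H = (rightUnitIso _).hom
    simp only [algOne, algMul, isoOfEquiv_hom, ← ofMap_id, tensorMap_ofMap, ofMap_comp_ofMap]
    exact ofMap_congr (X := tensor (groupAlgebra k H) (line k 1)) (Y := groupAlgebra k H) _
      (funext fun ⟨x, _⟩ => _root_.mul_one x)
  mul_assoc := by
    change tensorMap (algMul k H) (𝟙 _) ≫ algMul k H =
      (assocIso _ _ _).hom ≫ tensorMap (𝟙 _) (algMul k H) ≫ algMul k H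
    simp only [algMul, isoOfEquiv_hom, ← ofMap_id, tensorMap_ofMap, ofMap_comp_ofMap]
    exact ofMap_congr
      (X := tensor (tensor (groupAlgebra k H) (groupAlgebra k H)) (groupAlgebra k H))
      (Y := groupAlgebra k H) _ (funext fun ⟨⟨x, y⟩, z⟩ => _root_.mul_assoc x y z)

omit [Field k] in
lemma deg_freeAct (X : GradedVec k G)
    (p : (tensor (tensor X (groupAlgebra k H)) (groupAlgebra k H)).ι) :
    (tensor X (groupAlgebra k H)).deg (p.1.1, p.1.2 * p.2) =
      (tensor (tensor X (groupAlgebra k H)) (groupAlgebra k H)).deg p :=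
  (_root_.mul_assoc _ _ _).symm

lemma free_act (X : GradedVec k G) : ((free (groupAlgebra k H)).obj X).act =
    ofMap (X := tensor (tensor X (groupAlgebra k H)) (groupAlgebra k H))
      (Y := tensor X (groupAlgebra k H)) (fun p => (p.1.1, p.1.2 * p.2)) (deg_freeAct X) := by
  change (assocIso _ _ _).hom ≫ tensorMap (𝟙 _) (algMul k H) = _
  simp only [algMul, isoOfEquiv_hom, ← ofMap_id, tensorMap_ofMap, ofMap_comp_ofMap]
  rfl

/-! ### Modules over the group algebra are free -/

omit [Finite G] in
lemma tensorMap_id_comp_mat {X Y Z W : GradedVec k G} (f : X ⟶ Y) (g : tensor Y Z ⟶ W)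
    (i : X.ι) (z : Z.ι) (j : W.ι) :
    (tensorMap f (𝟙 Z) ≫ g).mat (i, z) j = ∑ x, f.mat i x * g.mat (x, z) j := by
  classical
  rw [comp_mat]
  refine (Fintype.sum_prod_type _).trans (Finset.sum_congr rfl fun x _ => ?_)
  refine (Fintype.sum_eq_single z fun y hy => ?_).trans ?_
  · rw [tensorMap_mat, id_mat, if_neg hy.symm, mul_zero, zero_mul]
  · rw [tensorMap_mat, id_mat, if_pos rfl, mul_one]

/-- The matrix coefficients of the action of `h : H` on a right module. -/
def actMat (M : RightMod (groupAlgebra k H)) (h : H) (i j : M.X.ι) : k :=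
  Hom.mat (X := tensor M.X (groupAlgebra k H)) (Y := M.X) M.act (i, ULift.up h) j

open scoped Classical in
lemma actMat_one (M : RightMod (groupAlgebra k H)) (i j : M.X.ι) :
    actMat M 1 i j = if i = j then 1 else 0 := by
  have h : tensorMap (𝟙 M.X) (algOne k H) ≫ M.act = (rightUnitIso M.X).hom := M.act_one
  have h' := congrArg (fun f => f.mat (i, PUnit.unit) j) h
  simp only [algOne, ← ofMap_id, tensorMap_ofMap] at h'
  exact (ofMap_comp_mat _ _ _ _ _).symm.trans h'

lemma sum_actMat_mul (M : RightMod (groupAlgebra k H)) (h h' : H) (i j : M.X.ι) :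
    ∑ x, actMat M h i x * actMat M h' x j = actMat M (h * h') i j := by
  have e : tensorMap M.act (𝟙 (groupAlgebra k H)) ≫ M.act =
    (assocIso _ _ _).hom ≫ tensorMap (𝟙 M.X) (algMul k H) ≫ M.act := M.act_assoc
  have e' := congrArg (fun f => f.mat ((i, ULift.up h), ULift.up h') j) e
  refine (tensorMap_id_comp_mat _ _ _ _ _).symm.trans (e'.trans ?_)
  simp only [algMul, isoOfEquiv_hom, ← ofMap_id, tensorMap_ofMap]
  refine (ofMap_comp_mat _ (deg_prodAssoc _ _ _) _ _ _).trans (ofMap_comp_mat _ _ _ _ _)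

lemma actMat_eq_zero (M : RightMod (groupAlgebra k H)) {h : H} {i j : M.X.ι}
    (e : M.X.deg i * h ≠ M.X.deg j) : actMat M h i j = 0 :=
  mat_eq_zero (X := tensor M.X (groupAlgebra k H)) M.act e

/-- A fixed representative of the coset of `g`. -/
abbrev cosetRep (H : Subgroup G) (g : G) : G := (QuotientGroup.mk (s := H) g).out

omit [Finite G] in
lemma cosetRep_inv_mul_mem (g : G) : (cosetRep H g)⁻¹ * g ∈ H := by
  rw [← QuotientGroup.eq, cosetRep, QuotientGroup.out_eq']

omit [Finite G] in
lemma cosetRep_eq {g g' : G} {h : H} (e : g * h = g') : cosetRep H g' = cosetRep H g := by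
  rw [cosetRep, cosetRep, ← e, QuotientGroup.mk_mul_of_mem _ h.2]

open scoped Classical in
/-- The part of a right module in the chosen coset representatives. -/
abbrev repPart (M : RightMod (groupAlgebra k H)) : GradedVec k G :=
  @GradedVec.mk k G {i : M.X.ι // M.X.deg i = cosetRep H (M.X.deg i)} inferInstance
    fun i => cosetRep H (M.X.deg i)

/-- The inclusion of the part in the chosen coset representatives. -/
def repPartIncl (M : RightMod (groupAlgebra k H)) : repPart M ⟶ M.X :=
  ofMap Subtype.val fun i => i.2

/-- The map `m ↦ m h⁻¹ ⊗ h`. -/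
def repPartInv (M : RightMod (groupAlgebra k H)) : M.X ⟶ tensor (repPart M) (groupAlgebra k H) :=
  ⟨fun j p => actMat M p.2.down⁻¹ j p.1.1, fun j p h => actMat_eq_zero M fun e => h <| by
    have : M.X.deg p.1.1 * p.2.down = M.X.deg j := by rw [← e]; simp
    rw [← this]
    exact congrArg (· * (p.2.down : G)) p.1.2⟩

/-- The map `m ⊗ h ↦ m h`. -/
def repPartHom (M : RightMod (groupAlgebra k H)) : tensor (repPart M) (groupAlgebra k H) ⟶ M.X :=
  (ofHom (repPartIncl M)).hom

lemma repPartHom_mat (M : RightMod (groupAlgebra k H)) (p : (repPart M).ι × ULift.{u} H)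
    (j : M.X.ι) : (repPartHom M).mat p j = actMat M p.2.down p.1.1 j := by
  obtain ⟨x, h⟩ := p
  change (tensorMap (repPartIncl M) (𝟙 _) ≫ M.act).mat _ _ = _
  refine (tensorMap_id_comp_mat _ _ _ _ _).trans ?_
  refine (Fintype.sum_eq_single x.1 fun y hy => ?_).trans ?_
  · rw [repPartIncl, ofMap_mat, if_neg hy.symm, zero_mul]
  · rw [repPartIncl, ofMap_mat, if_pos rfl, one_mul]
    rfl

lemma repPart_deg_eq (M : RightMod (groupAlgebra k H)) (x : (repPart M).ι) {i : M.X.ι} {h : H}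
    (e : M.X.deg i * h = M.X.deg x.1) : M.X.deg x.1 = cosetRep H (M.X.deg i) :=
  x.2.trans (cosetRep_eq e)

lemma repPart_hom_inv (M : RightMod (groupAlgebra k H)) :
    repPartHom M ≫ repPartInv M = 𝟙 (tensor (repPart M) (groupAlgebra k H)) := by
  classical
  refine GradedVec.hom_ext ?_
  rintro ⟨x, ⟨h⟩⟩ ⟨y, ⟨h'⟩⟩
  refine (Finset.sum_congr rfl fun j _ => congrArg (· * _) (repPartHom_mat M _ j)).trans
    ((sum_actMat_mul M h h'⁻¹ x.1 y.1).trans ?_)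
  rw [id_mat]
  by_cases e : M.X.deg x.1 * (h * h'⁻¹ : H) = M.X.deg y.1
  · have hd : M.X.deg y.1 = M.X.deg x.1 := (repPart_deg_eq M y e).trans x.2.symm
    have hh : h = h' := by
      rw [hd, mul_eq_left, ← H.coe_one, Subtype.coe_inj, mul_inv_eq_one] at e
      exact e
    subst hh
    rw [mul_inv_cancel, actMat_one]
    simp [Subtype.ext_iff]
  · rw [actMat_eq_zero M e, if_neg]
    intro hxy
    obtain ⟨rfl, hh⟩ := Prod.mk_inj.1 hxy
    obtain rfl := ULift.up_injective hh
    exact e (by simp)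

lemma repPart_inv_hom (M : RightMod (groupAlgebra k H)) :
    repPartInv M ≫ repPartHom M = 𝟙 M.X := by
  classical
  refine GradedVec.hom_ext fun i j => ?_
  -- the element of `H` that leads from the chosen representative to the degree of `i`
  let h : H := ⟨_, cosetRep_inv_mul_mem (M.X.deg i)⟩
  have hi (x : M.X.ι) : M.X.deg i * (h⁻¹ : H) = M.X.deg x ↔ M.X.deg x = cosetRep H (M.X.deg i) := by
    simp [h, eq_comm]
  refine (Finset.sum_congr rfl fun p _ =>
    congrArg (_ * ·) (repPartHom_mat M p j)).trans ?_
  refine (Fintype.sum_prod_type _).trans ?_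
  have h₁ (x : (repPart M).ι) : ∑ y : (groupAlgebra k H).ι,
      (repPartInv M).mat i (x, y) * actMat M y.down x.1 j =
        actMat M h⁻¹ i x.1 * actMat M h x.1 j := by
    refine Fintype.sum_eq_single (ULift.up h) fun y hy => ?_
    have h0 : actMat M y.down⁻¹ i x.1 = 0 := actMat_eq_zero M fun e => hy <| by
      have e' := e.trans ((hi x.1).2 (repPart_deg_eq M x e)).symm
      exact ULift.ext _ _ (inv_injective (Subtype.ext (mul_left_cancel e')))
    exact (congrArg (· * _) h0).trans (zero_mul _)
  refine (Finset.sum_congr rfl fun x _ => h₁ x).trans ?_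
  rw [id_mat, ← actMat_one M, ← inv_mul_cancel h, ← sum_actMat_mul,
    ← Fintype.sum_subtype_add_sum_subtype (fun x => M.X.deg x = cosetRep H (M.X.deg x))]
  refine (add_eq_left.2 (Finset.sum_eq_zero fun x _ => ?_)).symm
  rw [actMat_eq_zero M fun e => x.2 (((hi x).1 e).trans (cosetRep_eq e).symm), zero_mul]

/-- Every right module over a group algebra is free: it is generated by its components in degrees
that represent the cosets of `H`, since `h ∈ H` maps the component in degree `g` isomorphically to
that in degree `g h`. -/
def isoFree (M : RightMod (groupAlgebra k H)) :
    (free (groupAlgebra k H)).obj (repPart M) ≅ M :=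
  mkIso
    { hom := repPartHom M
      inv := repPartInv M
      hom_inv_id := repPart_hom_inv M
      inv_hom_id := repPart_inv_hom M }
    (ofHom (repPartIncl M)).act_hom

/-! ### Simple modules over the group algebra -/

/-- The free module on the line in the degree of the representative of a coset. -/
abbrev cosetMod (k : Type u) [Field k] {G : Type v} [Group G] [Finite G] {H : Subgroup G}
    (c : G ⧸ H) : RightMod (groupAlgebra k H) :=
  (free (groupAlgebra k H)).obj (line k c.out)

/-- A morphism of the free modules on two lines, as a morphism of graded vector spaces. -/
abbrev lineHom {g g' : G}
    (f : (free (groupAlgebra k H)).obj (line k g) ⟶ (free (groupAlgebra k H)).obj (line k g')) :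
    tensor (line k g) (groupAlgebra k H) ⟶ tensor (line k g') (groupAlgebra k H) := f.hom

omit [Finite G] in
lemma coset_eq_of_out_mul_eq {c d : G ⧸ H} {h h' : H} (e : c.out * (h : G) = d.out * (h' : G)) :
    c = d := by
  have := congrArg (QuotientGroup.mk (s := H)) e
  rwa [QuotientGroup.mk_mul_of_mem _ h.2, QuotientGroup.mk_mul_of_mem _ h'.2,
    QuotientGroup.out_eq', QuotientGroup.out_eq'] at this

/-- An endomorphism of the free module on a line is determined by its value on the generator, which
is a multiple of the generator for degree reasons. -/
lemma lineHom_mat_self {g : G}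
    (f : (free (groupAlgebra k H)).obj (line k g) ⟶ (free (groupAlgebra k H)).obj (line k g))
    (h : ULift.{u} H) :
    (lineHom f).mat (PUnit.unit, h) (PUnit.unit, h) =
      (lineHom f).mat (PUnit.unit, 1) (PUnit.unit, 1) := by
  classical
  have e : ((free (groupAlgebra k H)).obj (line k g)).act ≫ lineHom f =
    tensorMap (lineHom f) (𝟙 _) ≫ ((free (groupAlgebra k H)).obj (line k g)).act := f.act_hom
  rw [free_act] at e
  have e' := congrArg (fun t => t.mat ((PUnit.unit, (1 : ULift.{u} H)), h)
    (PUnit.unit, h)) e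
  refine Eq.trans ?_ ((((ofMap_comp_mat _ (deg_freeAct _) _ _ _).symm.trans e').trans
    (tensorMap_id_comp_mat _ _ _ _ _)).trans ?_)
  · rw [one_mul]
  · refine (Fintype.sum_eq_single (PUnit.unit, (1 : ULift.{u} H)) ?_).trans ?_
    · rintro ⟨⟨⟩, x⟩ hx
      rw [ofMap_mat, if_neg, mul_zero]
      intro h1
      exact hx (congrArg _ (mul_eq_right.1 (Prod.mk_inj.1 h1).2))
    · rw [ofMap_mat, if_pos, mul_one]
      · rfl
      · exact congrArg _ (one_mul h)

/-- The free modules on lines, one for each coset of `H`, are an orthogonal family of modules over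
the group algebra. -/
lemma isOrthogonalFamily_cosetMod :
    IsOrthogonalFamily k (cosetMod k : G ⧸ H → RightMod (groupAlgebra k H)) where
  hom_eq_zero c d hcd f := by
    refine RightMod.hom_ext (GradedVec.hom_ext ?_)
    rintro ⟨⟨⟩, h⟩ ⟨⟨⟩, h'⟩
    exact mat_eq_zero (lineHom f) fun e => hcd (coset_eq_of_out_mul_eq e)
  exists_smul c f := by
    classical
    refine ⟨(lineHom f).mat (PUnit.unit, 1) (PUnit.unit, 1),
      RightMod.hom_ext (GradedVec.hom_ext ?_)⟩
    rintro ⟨⟨⟩, (h : ULift.{u} H)⟩ ⟨⟨⟩, (h' : ULift.{u} H)⟩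
    change (lineHom f).mat (PUnit.unit, h) (PUnit.unit, h') = _ *
      (𝟙 (tensor (line k c.out) (groupAlgebra k H)) : _ ⟶ _).mat (PUnit.unit, h) (PUnit.unit, h')
    rw [id_mat]
    by_cases e : h = h'
    · subst e
      rw [if_pos rfl, mul_one]
      exact lineHom_mat_self f h
    · rw [if_neg fun e' => e (Prod.mk_inj.1 e').2, mul_zero]
      refine mat_eq_zero (lineHom f) fun e' => e ?_
      exact ULift.ext _ _ (Subtype.ext (mul_left_cancel e'))
  id_ne_zero c h := by
    apply one_ne_zero (α := k)
    have := congrArg (fun f => (lineHom f).mat (PUnit.unit, 1) (PUnit.unit, 1)) h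
    exact (if_pos rfl).symm.trans this
  exists_iso_biproduct M := by
    classical
    let e := Finite.equivFin (repPart M).ι
    let a (i : Fin (Nat.card (repPart M).ι)) : G ⧸ H := QuotientGroup.mk (M.X.deg (e.symm i).1)
    exact ⟨_, a, ⟨(isoFree M).symm ≪≫ (free (groupAlgebra k H)).mapIso (biproduct.uniqueUpToIso _
      (biconeIsBilimit (fun i => line k (a i).out) (repPart M)
        ((Equiv.sigmaPUnit _).trans e.symm) fun _ _ => rfl)) ≪≫
      (free (groupAlgebra k H)).mapBiproduct _⟩⟩

instance : IsSemisimpleCategory (RightMod (groupAlgebra k H)) :=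
  isOrthogonalFamily_cosetMod.isSemisimpleCategory

omit [Field k] in
lemma deg_shift {g g' : G} (hg : g'⁻¹ * g ∈ H) (p : (tensor (line k g) (groupAlgebra k H)).ι) :
    (tensor (line k g') (groupAlgebra k H)).deg
      (Equiv.prodCongr (Equiv.refl _) (Equiv.mulLeft (ULift.up ⟨g'⁻¹ * g, hg⟩)) p) =
        (tensor (line k g) (groupAlgebra k H)).deg p := by
  change g' * (g'⁻¹ * g * (p.2.down : G)) = g * p.2.down
  group

/-- The free module on the line in degree `g` depends only on the coset `g H`: the
isomorphism sends the basis vector `h` to `g'⁻¹ g h`. -/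
def freeLineIso {g g' : G} (hg : g'⁻¹ * g ∈ H) :
    (free (groupAlgebra k H)).obj (line k g) ≅ (free (groupAlgebra k H)).obj (line k g') :=
  mkIso (isoOfEquiv (X := tensor (line k g) (groupAlgebra k H))
    (Y := tensor (line k g') (groupAlgebra k H))
    (Equiv.prodCongr (Equiv.refl _) (Equiv.mulLeft (ULift.up ⟨g'⁻¹ * g, hg⟩))) (deg_shift hg)) <| by
    rw [free_act, free_act]
    change ofMap _ (deg_freeAct (line k g)) ≫ ofMap _ (deg_shift hg) =
      tensorMap (ofMap _ (deg_shift hg)) (ofMap id fun _ => rfl) ≫ ofMap _ (deg_freeAct (line k g'))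
    rw [tensorMap_ofMap, ofMap_comp_ofMap, ofMap_comp_ofMap]
    exact ofMap_congr (X := tensor (tensor (line k g) (groupAlgebra k H)) (groupAlgebra k H))
      (Y := tensor (line k g') (groupAlgebra k H)) _
      (funext fun ⟨⟨_, x⟩, y⟩ => congrArg (Prod.mk PUnit.unit) (mul_assoc _ x y).symm)

omit [Field k] [Finite G] in
lemma deg_lineTensor (g g' : G) (p : (tensor (line k g) (line k g')).ι) :
    (line k (g * g')).deg (Equiv.prodPUnit PUnit p) = (tensor (line k g) (line k g')).deg p := rfl

omit [Field k] in
lemma deg_lineIncl (h : H) (x : (line k (h : G)).ι) :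
    (groupAlgebra k H).deg (ULift.up h) = (line k (h : G)).deg x := rfl

/-- The tensor product of lines. -/
def lineTensorIso (g g' : G) : line k g ⊗ line k g' ≅ line k (g * g') :=
  isoOfEquiv (X := tensor (line k g) (line k g')) (Y := line k (g * g'))
    (Equiv.prodPUnit PUnit) (deg_lineTensor g g')

/-- The line spanned by `h` in the group algebra. -/
def lineIncl (h : H) : line k (h : G) ⟶ groupAlgebra k H :=
  ofMap (fun _ => ULift.up h) (deg_lineIncl h)

/-- The group algebra is the direct sum of the lines spanned by the elements of `H`. -/
def groupAlgebraIsColimit :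
    IsColimit (Cofan.mk (groupAlgebra k H) fun h : H => lineIncl (k := k) h) :=
  Cofan.IsColimit.mk _
    (fun s => ⟨fun x j => Hom.mat (X := line k (x.down : G)) (s.inj x.down) PUnit.unit j,
      fun x _ h => mat_eq_zero (X := line k (x.down : G)) (s.inj x.down) h⟩)
    (fun s h => GradedVec.hom_ext fun _ _ => ofMap_comp_mat _ (fun _ => rfl) _ _ _)
    (fun s m hm => GradedVec.hom_ext fun x j => by
      have := congrArg (fun t => Hom.mat (X := line k (x.down : G)) t PUnit.unit j) (hm x.down)
      exact (ofMap_comp_mat (X := line k (x.down : G)) (Y := groupAlgebra k H)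
        (fun _ => ULift.up x.down) (fun _ => rfl) m PUnit.unit j).symm.trans
        this)

lemma lineIncl_tensor_mul (h h' : H) :
    (lineIncl h ⊗ₘ lineIncl h') ≫ MonObj.mul (X := groupAlgebra k H) =
      (lineTensorIso (h : G) h').hom ≫ lineIncl (h * h') := by
  change tensorMap (ofMap _ (deg_lineIncl h)) (ofMap _ (deg_lineIncl h')) ≫ ofMap _ deg_mul =
    ofMap _ (deg_lineTensor (k := k) (h : G) h') ≫ ofMap _ (deg_lineIncl (h * h'))
  rw [tensorMap_ofMap, ofMap_comp_ofMap, ofMap_comp_ofMap]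
  rfl

end

end GradedVec

/-! ### Isomorphisms of Grothendieck rings and modules on basis elements -/

/-- An additive map that is compatible with the action of basis elements on basis elements is
compatible with the whole action. -/
lemma map_smul_of_basis {R A P M N I L : Type*} [Ring R] [AddCommGroup A] [Module R A]
    [AddCommGroup P] [AddCommGroup M] [AddCommGroup N] (b : Module.Basis I ℤ R)
    (m : Module.Basis L ℤ A) (f : R →ₗ[ℤ] P) (g : A →ₗ[ℤ] M) (g' : A →ₗ[ℤ] N)
    (φ : P →ₗ[ℤ] M →ₗ[ℤ] N) (h : ∀ i l, g' (b i • m l) = φ (f (b i)) (g (m l))) (r : R) (a : A) :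
    g' (r • a) = φ (f r) (g a) := by
  have key : (Algebra.lsmul ℤ ℤ A : R →ₐ[ℤ] A →ₗ[ℤ] A).toLinearMap.compr₂ g' = φ.compl₁₂ f g :=
    b.ext fun i => m.ext fun l => by simpa using h i l
  simpa using LinearMap.congr_fun (LinearMap.congr_fun key r) a

section Gr

variable {A L : Type*} [AddCommGroup A]

lemma toGr_basis (m : Module.Basis L ℤ A) {D : Type*} [Category* D] [HasZeroMorphisms D]
    (e : L ≃ SimpleClass D) (l : L) : toGr m e (m l) = Finsupp.single (e l) 1 := by
  simp [toGr]

lemma grMul_single (k : Type*) [Field k] {C : Type*} [Category* C] [Preadditive C] [Linear k C]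
    [MonoidalCategory C] (S T : SimpleClass C) :
    grMul k C (Finsupp.single S 1) (Finsupp.single T 1) = classOf k (S.rep ⊗ T.rep) := by
  simp [grMul]

open scoped MonoidalLeftAction in
lemma grAct_single (k : Type*) [Field k] {C : Type*} [Category* C] [Preadditive C]
    [MonoidalCategory C] {D : Type*} [Category* D] [Preadditive D] [Linear k D]
    [MonoidalLeftAction C D] (S : SimpleClass C) (T : SimpleClass D) :
    grAct k C D (Finsupp.single S 1) (Finsupp.single T 1) = classOf k (S.rep ⊙ₗ T.rep : D) := by
  simp [grAct]

variable {k : Type*} [Field k] {R I : Type*} [Ring R] [Finite I] {F : FusionRing R I}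
  {C : Type*} [Category* C] [Preadditive C] [Linear k C] [MonoidalCategory C]

/-- A bijection of bases that is multiplicative on basis elements is an isomorphism of based
rings. -/
def GrRingIso.ofBasis (e : I ≃ SimpleClass C)
    (h_one : classOf k (𝟙_ C) = Finsupp.single (e F.unit) 1)
    (h_mul : ∀ i j, toGr F.basis e (F.basis i * F.basis j) = classOf k ((e i).rep ⊗ (e j).rep)) :
    GrRingIso k F C where
  e := e
  map_one := by rw [h_one, ← F.basis_unit, toGr_basis]
  map_mul := map_smul_of_basis F.basis F.basis (toGr F.basis e).toLinearMap
    (toGr F.basis e).toLinearMap (toGr F.basis e).toLinearMap (grMul k C) fun i j => by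
      simp only [LinearEquiv.coe_coe, toGr_basis, grMul_single, smul_eq_mul, h_mul]

open scoped MonoidalLeftAction in
/-- A bijection of bases that is compatible with the action of basis elements on basis elements is
an isomorphism of based modules. -/
def GrModIso.ofBasis {σ : GrRingIso k F C} {A : Type*} [AddCommGroup A] [Module R A] {L : Type*}
    {N : NIMRep F A L} {D : Type*} [Category* D] [Preadditive D] [Linear k D]
    [MonoidalLeftAction C D] (e : L ≃ SimpleClass D)
    (h : ∀ i l, toGr N.basis e (F.basis i • N.basis l) =
      classOf k ((σ.e i).rep ⊙ₗ (e l).rep : D)) : GrModIso σ N D where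
  e := e
  map_smul := map_smul_of_basis F.basis N.basis (toGr F.basis σ.e).toLinearMap
    (toGr N.basis e).toLinearMap (toGr N.basis e).toLinearMap (grAct k C D) fun i l => by
      simp only [LinearEquiv.coe_coe, toGr_basis, grAct_single, h]

/-- A realization of a NIM-rep is a realization of every equivalent NIM-rep. -/
def GrModIso.ofEquivalent {σ : GrRingIso k F C} {A : Type*} [AddCommGroup A] [Module R A]
    {L : Type*} {N : NIMRep F A L} {A' : Type*} [AddCommGroup A'] [Module R A'] {L' : Type*}
    {N' : NIMRep F A' L'} {D : Type*} [Category* D] [Preadditive D] [Linear k D]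
    [MonoidalLeftAction C D] (τ : GrModIso σ N' D) (e : L ≃ L') (f : A ≃ₗ[R] A')
    (hf : ∀ l, f (N.basis l) = N'.basis (e l)) : GrModIso σ N D where
  e := e.trans τ.e
  map_smul r a := by
    have h : (toGr N.basis (e.trans τ.e)).toLinearMap =
        (toGr N'.basis τ.e).toLinearMap ∘ₗ f.toLinearMap.restrictScalars ℤ :=
      N.basis.ext fun l => by simp [toGr_basis, hf]
    have h' (x : A) : toGr N.basis (e.trans τ.e) x = toGr N'.basis τ.e (f x) :=
      LinearMap.congr_fun h x
    rw [h', h', f.map_smul, τ.map_smul]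

end Gr

/-! ### Irreducible NIM-reps of a group ring -/

section GroupRing

variable {G : Type*} [Group G] [Finite G]

/-- A finitely supported family of non-negative integers with `∑ c² = 1` is a unit vector. -/
lemma exists_eq_single_of_sum_sq {L : Type*} (c : L →₀ ℤ) (h0 : ∀ l, 0 ≤ c l)
    (h1 : c.sum (fun _ x => x * x) = 1) : ∃ l, c = Finsupp.single l 1 := by
  classical
  have hne : c ≠ 0 := by
    rintro rfl
    simp at h1
  obtain ⟨l, hl⟩ := Finsupp.support_nonempty_iff.2 hne
  have hpos (x : L) (hx : x ∈ c.support) : 1 ≤ c x :=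
    (h0 x).lt_of_ne' (Finsupp.mem_support_iff.1 hx)
  have hsq (x : L) (hx : x ∈ c.support) : 1 ≤ c x * c x := one_le_mul_of_one_le_of_one_le
    (hpos x hx) (hpos x hx)
  refine ⟨l, ?_⟩
  rw [Finsupp.sum, ← Finset.add_sum_erase _ _ hl] at h1
  have hrest : ∑ x ∈ c.support.erase l, c x * c x = 0 :=
    le_antisymm (by linarith [hsq l hl]) (Finset.sum_nonneg fun x _ => mul_self_nonneg _)
  have hcl : c l = 1 := by
    have h2 := hpos l hl
    nlinarith
  ext x
  by_cases hx : l = x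
  · subst hx
    simp [hcl]
  · rw [Finsupp.single_eq_of_ne (Ne.symm hx)]
    by_contra hx0
    have hmem : x ∈ c.support.erase l :=
      Finset.mem_erase.2 ⟨Ne.symm hx, Finsupp.mem_support_iff.2 hx0⟩
    have := (Finset.sum_eq_zero_iff_of_nonneg fun y _ => mul_self_nonneg (c y)).1 hrest x hmem
    exact hx0 (mul_self_eq_zero.1 this)

lemma basisForm_basis {A L : Type*} [AddCommGroup A] (m : Module.Basis L ℤ A) (x : A) (l : L) :
    basisForm m x (m l) = m.repr x l ∧ basisForm m (m l) x = m.repr x l := by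
  classical
  refine ⟨?_, by simp [basisForm]⟩
  simp [basisForm, Finsupp.single_apply, Finsupp.sum, eq_comm]

variable {A L : Type*} [AddCommGroup A] [Module (MonoidAlgebra ℤ G) A]
  (N : NIMRep (groupFusionRing G) A L)

/-- Group elements permute the basis of a NIM-rep: by rigidity the matrix of `g⁻¹` is the transpose
of that of `g`, and a non-negative integral matrix whose inverse is its transpose is a permutation
matrix. -/
lemma NIMRep.exists_smul_basis (g : G) (l : L) :
    ∃ l', groupBasis G g • N.basis l = N.basis l' := by
  have rigid (j : L) : N.basis.repr (groupBasis G g • N.basis l) j =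
      N.basis.repr (groupBasis G g⁻¹ • N.basis j) l := by
    rw [← (basisForm_basis N.basis _ j).1, ← (basisForm_basis N.basis _ l).2]
    exact N.rigid g l j
  set c := N.basis.repr (groupBasis G g • N.basis l) with hc
  have hinv : groupBasis G g⁻¹ • groupBasis G g • N.basis l = N.basis l := by
    rw [smul_smul, groupBasis_mul, inv_mul_cancel, groupBasis_apply, ← MonoidAlgebra.one_def,
      one_smul]
  have h1 : c.sum (fun _ x => x * x) = 1 := by
    have h2 : groupBasis G g • N.basis l = c.sum fun j x => x • N.basis j := by
      rw [← Finsupp.linearCombination_apply, hc, N.basis.linearCombination_repr]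
    have h3 := congrArg (fun x => N.basis.repr x l) hinv
    simp only [h2, Finsupp.sum, Finset.smul_sum, map_sum, Finsupp.finsetSum_apply,
      smul_comm (groupBasis G g⁻¹) (_ : ℤ), map_smul, Finsupp.smul_apply, ← rigid,
      Module.Basis.repr_self, Finsupp.single_eq_same, smul_eq_mul] at h3
    exact h3
  obtain ⟨l', hl'⟩ := exists_eq_single_of_sum_sq c (N.nonneg g l) h1
  refine ⟨l', N.basis.repr.injective ?_⟩
  rw [← hc, hl', Module.Basis.repr_self]

/-- The permutation of the basis of a NIM-rep given by a group element. -/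
noncomputable def NIMRep.perm (g : G) (l : L) : L := (N.exists_smul_basis g l).choose

lemma NIMRep.smul_basis (g : G) (l : L) : groupBasis G g • N.basis l = N.basis (N.perm g l) :=
  (N.exists_smul_basis g l).choose_spec

/-- The action of `G` on the basis of a NIM-rep. -/
@[reducible]
noncomputable def NIMRep.mulAction : MulAction G L where
  smul := N.perm
  one_smul l := N.basis.injective <| by
    change N.basis (N.perm 1 l) = _
    rw [← N.smul_basis, groupBasis_apply, ← MonoidAlgebra.one_def, one_smul]
  mul_smul g h l := N.basis.injective <| by
    change N.basis (N.perm (g * h) l) = N.basis (N.perm g (N.perm h l))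
    rw [← N.smul_basis, ← N.smul_basis, ← N.smul_basis, ← groupBasis_mul, mul_smul]

/-- The basis of an irreducible NIM-rep is a transitive `G`-set, that is a set of cosets. -/
theorem NIMRep.IsIrreducible.exists_equivalent (hN : N.IsIrreducible) :
    ∃ H : Subgroup G, N.Equivalent (cosetNIMRep H) := by
  let _ := N.mulAction
  have hact (g : G) (l : L) : groupBasis G g • N.basis l = N.basis (g • l) := N.smul_basis g l
  obtain ⟨⟨l₀⟩, hirr⟩ := hN
  have hsub : N.IsSub (MulAction.orbit G l₀) := by
    have hg (g : G) (a : A) (ha : a ∈ Submodule.span ℤ (N.basis '' MulAction.orbit G l₀)) :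
        groupBasis G g • a ∈ Submodule.span ℤ (N.basis '' MulAction.orbit G l₀) := by
      induction ha using Submodule.span_induction with
      | mem x hx =>
        obtain ⟨l, hl, rfl⟩ := hx
        exact Submodule.subset_span ⟨g • l, MulAction.mem_orbit_of_mem_orbit g hl, (hact g l).symm⟩
      | zero => simp
      | add x y _ _ hx hy => simpa using add_mem hx hy
      | smul n x _ hx => simpa [smul_comm _ n] using Submodule.smul_mem _ n hx
    intro r a ha
    induction (groupBasis G).mem_span r using Submodule.span_induction with
    | mem x hx =>
      obtain ⟨g, rfl⟩ := hx
      exact hg g a ha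
    | zero => simp
    | add x y _ _ hx hy => simpa [add_smul] using add_mem hx hy
    | smul n x _ hx => simpa only [smul_assoc] using Submodule.smul_mem _ n hx
  have horb : MulAction.orbit G l₀ = Set.univ :=
    (hirr _ hsub).resolve_left (MulAction.nonempty_orbit l₀).ne_empty
  let e : L ≃ G ⧸ MulAction.stabilizer G l₀ := (Equiv.Set.univ L).symm.trans
    ((Equiv.setCongr horb.symm).trans (MulAction.orbitEquivQuotientStabilizer G l₀))
  have he_symm (g : G) : e.symm (QuotientGroup.mk g) = g • l₀ := rfl
  have he (g : G) (l : L) : e (g • l) = g • e l := by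
    obtain ⟨x, hx⟩ := QuotientGroup.mk_surjective (e l)
    apply e.symm.injective
    rw [e.symm_apply_apply, ← hx]
    change _ = e.symm (QuotientGroup.mk (g * x))
    rw [he_symm, mul_smul, ← he_symm x, hx, e.symm_apply_apply]
  let f : A ≃ₗ[ℤ] CosetModule (MulAction.stabilizer G l₀) := N.basis.equiv (cosetBasis _) e
  refine ⟨MulAction.stabilizer G l₀, e, { f with
    map_smul' := map_smul_of_basis (groupBasis G) N.basis LinearMap.id f.toLinearMap f.toLinearMap
      (Algebra.lsmul ℤ ℤ _).toLinearMap fun g l => ?_ }, fun l => ?_⟩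
  · simp [f, hact, he, smul_cosetBasis]
  · exact N.basis.equiv_apply l _ e

/-- The coset NIM-reps are irreducible. -/
theorem cosetNIMRep_isIrreducible (H : Subgroup G) : (cosetNIMRep H).IsIrreducible := by
  refine ⟨⟨QuotientGroup.mk 1⟩, fun S hS => ?_⟩
  rw [or_iff_not_imp_left, ← ne_eq, ← Set.nonempty_iff_ne_empty]
  rintro ⟨c, hc⟩
  refine Set.eq_univ_of_forall fun d => ?_
  obtain ⟨g, rfl⟩ := MulAction.exists_smul_eq G c d
  have h := hS (groupBasis G g) _ (Submodule.subset_span ⟨c, hc, rfl⟩)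
  have h' : cosetBasis H (g • c) ∈ Submodule.span ℤ (cosetBasis H '' S) := by
    rw [← smul_cosetBasis]
    exact h
  rw [Module.Basis.mem_span_image, Module.Basis.repr_self] at h'
  exact h' (by simp)

end GroupRing

/-! ### Internal endomorphism algebras from universal actions -/

open MonoidalLeftAction

section Universal

variable {C : Type*} [Category* C] [MonoidalCategory C] {D : Type*} [Category* D]
  [MonoidalLeftAction C D] {N : D}

/-- A morphism `a : E ⊙ N ⟶ N` is universal if it exhibits `E` as representing
`X ↦ Hom(X ⊙ N, N)`. -/
def IsUniversalAction {E : C} (a : (E ⊙ₗ N : D) ⟶ N) : Prop :=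
  ∀ X : C, Function.Bijective (fun f : X ⟶ E => (f ⊵ₗ N ≫ a : (X ⊙ₗ N : D) ⟶ N))

namespace IsUniversalAction

variable {E : C} {a : (E ⊙ₗ N : D) ⟶ N} (ha : IsUniversalAction a)
include ha

lemma hom_ext {X : C} {f g : X ⟶ E} (h : f ⊵ₗ N ≫ a = g ⊵ₗ N ≫ a) : f = g := (ha X).1 h

/-- The morphism to the representing object that corresponds to a morphism `X ⊙ N ⟶ N`. -/
noncomputable def lift {X : C} (t : (X ⊙ₗ N : D) ⟶ N) : X ⟶ E := ((ha X).2 t).choose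

lemma lift_comp {X : C} (t : (X ⊙ₗ N : D) ⟶ N) : ha.lift t ⊵ₗ N ≫ a = t := ((ha X).2 t).choose_spec

/-- The algebra structure on a representing object, given by composing endomorphisms. -/
@[reducible]
noncomputable def monObj : MonObj E where
  one := ha.lift (MonoidalLeftActionStruct.actionUnitIso N).hom
  mul := ha.lift ((αₗ E E N).hom ≫ E ⊴ₗ a ≫ a)
  one_mul := ha.hom_ext <| by
    rw [comp_actionHomLeft, Category.assoc, lift_comp, whiskerRight_actionHomLeft]
    simp only [Category.assoc, Iso.inv_hom_id_assoc]
    rw [← action_exchange_assoc, lift_comp, ← actionUnitIso_hom_naturality,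
      leftUnitor_actionHom, Category.assoc]
  mul_one := ha.hom_ext <| by
    rw [comp_actionHomLeft, Category.assoc, lift_comp, whiskerLeft_actionHomLeft]
    simp only [Category.assoc, Iso.inv_hom_id_assoc]
    rw [← actionHomRight_comp_assoc, lift_comp, rightUnitor_actionHom, Category.assoc]
  mul_assoc := ha.hom_ext <| by
    rw [comp_actionHomLeft, Category.assoc, lift_comp, whiskerRight_actionHomLeft]
    simp only [Category.assoc, Iso.inv_hom_id_assoc]
    rw [← action_exchange_assoc, lift_comp, comp_actionHomLeft, comp_actionHomLeft, Category.assoc,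
      Category.assoc, lift_comp, whiskerLeft_actionHomLeft]
    simp only [Category.assoc, Iso.inv_hom_id_assoc]
    rw [← actionHomRight_comp_assoc E (ha.lift _ ⊵ₗ N), lift_comp]
    simp

/-- The action of the representing algebra. -/
@[reducible]
noncomputable def modObj : @ModObj _ _ _ _ _ _ E ha.monObj N :=
  @ModObj.mk _ _ _ _ _ _ E ha.monObj N a (ha.lift_comp _) (ha.lift_comp _)

/-- Representing objects are unique. -/
lemma exists_iso {E' : C} {a' : (E' ⊙ₗ N : D) ⟶ N} (ha' : IsUniversalAction a') :
    ∃ e : E ≅ E', e.hom ⊵ₗ N ≫ a' = a :=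
  ⟨⟨ha'.lift a, ha.lift a', ha.hom_ext (by simp [lift_comp]), ha'.hom_ext (by simp [lift_comp])⟩,
    ha'.lift_comp a⟩

end IsUniversalAction

end Universal

/-! ### The representing object of `X ↦ Hom(X ⊙ N, N)` -/

lemma exists_smul_of_iso (k : Type*) [Field k] [IsAlgClosed k] {D : Type*} [Category* D]
    [Preadditive D] [Linear k D] [HasKernels D] {X Y : D} [Simple X]
    [FiniteDimensional k (X ⟶ X)] (r : X ≅ Y) (f : X ⟶ Y) : ∃ c : k, f = c • r.hom := by
  obtain ⟨c, hc⟩ := endomorphism_simple_eq_smul_id k (f ≫ r.inv)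
  refine ⟨c, ?_⟩
  have := congrArg (· ≫ r.hom) hc
  simpa using this.symm

lemma hom_eq_zero_of_not_iso {D : Type*} [Category* D] [Preadditive D] [HasKernels D] {X Y : D}
    [Simple X] [Simple Y] (h : ¬ Nonempty (X ≅ Y)) (f : X ⟶ Y) : f = 0 := by
  by_contra hf
  have := isIso_of_hom_simple hf
  exact h ⟨asIso f⟩

section InternalEnd

variable {k : Type*} [Field k] [IsAlgClosed k] {C : Type*} [Category* C] [Preadditive C]
  [Linear k C] [MonoidalCategory C] [MonoidalPreadditive C] [MonoidalLinear k C] {A : C} [MonObj A]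

lemma add_actionHomLeft {X Y : C} (f g : X ⟶ Y) (N : RightMod A) :
    (f + g) ⊵ₗ N = f ⊵ₗ N + g ⊵ₗ N :=
  RightMod.hom_ext (MonoidalPreadditive.add_whiskerRight f g)

lemma zero_actionHomLeft (X Y : C) (N : RightMod A) : (0 : X ⟶ Y) ⊵ₗ N = 0 :=
  RightMod.hom_ext MonoidalPreadditive.zero_whiskerRight

lemma sum_actionHomLeft {α : Type*} (s : Finset α) {X Y : C} (f : α → (X ⟶ Y)) (N : RightMod A) :
    (∑ x ∈ s, f x) ⊵ₗ N = ∑ x ∈ s, f x ⊵ₗ N :=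
  map_sum (AddMonoidHom.mk' (fun t : X ⟶ Y => t ⊵ₗ N) fun f g => add_actionHomLeft f g N) f s

omit [IsAlgClosed k] in
lemma smul_actionHomLeft (c : k) {X Y : C} (f : X ⟶ Y) (N : RightMod A) :
    (c • f) ⊵ₗ N = c • f ⊵ₗ N :=
  RightMod.hom_ext (MonoidalLinear.smul_whiskerRight c f N.X)

variable [IsSemisimpleCategory C] {ι : Type*} [Fintype ι] {b : ι → C} {N : RightMod A}

/-- Isomorphisms `b i ⊙ N ≅ N` assemble to a morphism `(⨁ b) ⊙ N ⟶ N`. -/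
noncomputable def sumAction (φ : ∀ i, (b i ⊙ₗ N : RightMod A) ≅ N) :
    ((⨁ b) ⊙ₗ N : RightMod A) ⟶ N :=
  ∑ i, biproduct.π b i ⊵ₗ N ≫ (φ i).hom

variable (φ : ∀ i, (b i ⊙ₗ N : RightMod A) ≅ N)

lemma comp_sumAction {X : C} (f : X ⟶ ⨁ b) :
    f ⊵ₗ N ≫ sumAction φ = ∑ i, (f ≫ biproduct.π b i) ⊵ₗ N ≫ (φ i).hom := by
  simp only [sumAction, Preadditive.comp_sum, comp_actionHomLeft, Category.assoc]

lemma ι_sumAction (i : ι) : biproduct.ι b i ⊵ₗ N ≫ sumAction φ = (φ i).hom := by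
  classical
  rw [comp_sumAction, Fintype.sum_eq_single i]
  · simp
  · intro j hj
    rw [biproduct.ι_π_ne b hj.symm, zero_actionHomLeft, zero_comp]

/-- If the `b i` are, up to isomorphism, exactly the simple objects `S` with `Hom(S ⊙ N, N) ≠ 0`,
and `b i ⊙ N ≅ N` for all `i`, then `⨁ b` represents `X ↦ Hom(X ⊙ N, N)`: by additivity this needs
to be checked on simple objects `X` only, where Schur's lemma applies. -/
lemma isUniversalAction_sumAction [∀ X Y : C, FiniteDimensional k (X ⟶ Y)] [HasKernels (RightMod A)]
    [Simple N] [∀ i, Simple (b i)] (hb : ∀ i j, Nonempty (b i ≅ b j) → i = j)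
    (hN : ∀ S : C, Simple S → (∃ i, Nonempty (S ≅ b i)) ∨
      ∀ t : (S ⊙ₗ N : RightMod A) ⟶ N, t = 0) :
    IsUniversalAction (sumAction φ) := by
  classical
  have simple_case (S : C) (hS : Simple S) : (∀ f : S ⟶ ⨁ b, f ⊵ₗ N ≫ sumAction φ = 0 → f = 0) ∧
      ∀ t : (S ⊙ₗ N : RightMod A) ⟶ N, ∃ f : S ⟶ ⨁ b, f ⊵ₗ N ≫ sumAction φ = t := by
    by_cases hex : ∃ i, Nonempty (S ≅ b i)
    · obtain ⟨i, ⟨r⟩⟩ := hex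
      let ψ : (S ⊙ₗ N : RightMod A) ≅ N := asIso (r.hom ⊵ₗ N) ≪≫ φ i
      have hψ : Simple (S ⊙ₗ N : RightMod A) := Simple.of_iso ψ
      have hπ (f : S ⟶ ⨁ b) (j : ι) (hj : j ≠ i) : f ≫ biproduct.π b j = 0 :=
        hom_eq_zero_of_not_iso (fun ⟨e⟩ => hj (hb j i ⟨e.symm ≪≫ r⟩)) _
      constructor
      · intro f hf
        obtain ⟨c, hc⟩ := exists_smul_of_iso k r (f ≫ biproduct.π b i)
        rw [comp_sumAction, Fintype.sum_eq_single i, hc, smul_actionHomLeft,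
          Linear.smul_comp] at hf
        · have hc0 : c = 0 := by
            refine (smul_eq_zero.1 hf).resolve_right fun h => id_nonzero N ?_
            have h' : ψ.hom = 0 := h
            rw [← ψ.inv_hom_id, h', comp_zero]
          refine biproduct.hom_ext _ _ fun j => ?_
          rw [zero_comp]
          by_cases hj : j = i
          · subst hj
            rw [hc, hc0, zero_smul]
          · exact hπ f j hj
        · intro j hj
          rw [hπ f j hj, zero_actionHomLeft, zero_comp]
      · intro t
        obtain ⟨c, hc⟩ := exists_smul_of_iso k ψ t
        refine ⟨c • (r.hom ≫ biproduct.ι b i), ?_⟩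
        rw [smul_actionHomLeft, Linear.smul_comp, comp_actionHomLeft, Category.assoc,
          ι_sumAction, hc]
        rfl
    · refine ⟨fun f _ => biproduct.hom_ext _ _ fun i => ?_, fun t => ⟨0, ?_⟩⟩
      · rw [zero_comp]
        exact hom_eq_zero_of_not_iso (fun h => hex ⟨i, h⟩) _
      · rw [zero_actionHomLeft, zero_comp, (hN S hS).resolve_left hex t]
  intro X
  obtain ⟨n, S, hS, ⟨e⟩⟩ := IsSemisimpleCategory.exists_decomposition X
  let s (i : Fin n) : S i ⟶ X := biproduct.ι S i ≫ e.inv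
  constructor
  · intro f g hfg
    rw [← cancel_epi e.inv]
    refine biproduct.hom_ext' _ _ fun i => sub_eq_zero.1 ((simple_case (S i) (hS i)).1 _ ?_)
    have hfg' : f ⊵ₗ N ≫ sumAction φ = g ⊵ₗ N ≫ sumAction φ := hfg
    rw [sub_eq_add_neg, add_actionHomLeft, ← neg_one_smul k, smul_actionHomLeft]
    simp only [comp_actionHomLeft, Preadditive.add_comp, Linear.smul_comp, Category.assoc, hfg']
    simp
  · intro t
    choose f hf using fun i => (simple_case (S i) (hS i)).2 (s i ⊵ₗ N ≫ t)
    refine ⟨e.hom ≫ ∑ i, biproduct.π S i ≫ f i, ?_⟩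
    have total : e.hom ≫ ∑ i, biproduct.π S i ≫ s i = 𝟙 X := by
      simp only [s, ← Category.assoc, ← Preadditive.sum_comp, biproduct.total]
      simp
    have h : (e.hom ≫ ∑ i, biproduct.π S i ≫ f i) ⊵ₗ N ≫ sumAction φ =
        (e.hom ≫ ∑ i, biproduct.π S i ≫ s i) ⊵ₗ N ≫ t := by
      simp only [comp_actionHomLeft, sum_actionHomLeft, Preadditive.sum_comp, Category.assoc, hf]
    rw [total, id_actionHomLeft, Category.id_comp] at h
    exact h

end InternalEnd

/-! ### Simple objects in a realization -/

section Realized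

variable {k : Type u} [Field k] [IsAlgClosed k] {G : Type v} [Group G] [Finite G]

lemma GrModIso.nonempty_action_iso {C : Type*} [Category* C] [Preadditive C]
    [Linear k C] [MonoidalCategory C] {H : Subgroup G} {D : Type*} [Category* D] [Preadditive D]
    [Linear k D] [MonoidalLeftAction C D] [IsSemisimpleCategory D]
    [∀ X Y : D, FiniteDimensional k (X ⟶ Y)] {σ : GrRingIso k (groupFusionRing G) C}
    (τ : GrModIso σ (cosetNIMRep H) D) (g : G)
    (c : G ⧸ H) : Nonempty (((σ.e g).rep ⊙ₗ (τ.e c).rep : D) ≅ (τ.e (g • c)).rep) := by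
  have := Finite.of_equiv _ τ.e
  refine nonempty_iso_rep_of_classOf k ?_
  have h1 := τ.map_smul (groupBasis G g) (cosetBasis H c)
  rw [smul_cosetBasis] at h1
  rw [← grAct_single, ← toGr_basis (groupFusionRing G).basis σ.e g,
    ← toGr_basis (cosetNIMRep H).basis τ.e c, ← toGr_basis (cosetNIMRep H).basis τ.e]
  exact h1.symm

open scoped MonObj in
/-- The product in an algebra acting on `N`, restricted along `f` and `g`, acts on `N` as the
composite of the restricted actions. -/
lemma tensorHom_mul_actionHomLeft {C : Type*} [Category* C] [MonoidalCategory C] {D : Type*}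
    [Category* D] [MonoidalLeftAction C D] {N : D} {E : C} [MonObj E] [ModObj E N] {X Y : C}
    (f : X ⟶ E) (g : Y ⟶ E) :
    ((f ⊗ₘ g) ≫ μ[E]) ⊵ₗ N ≫ ModObj.smul =
      (αₗ X Y N).hom ≫ X ⊴ₗ (g ⊵ₗ N ≫ ModObj.smul) ≫ f ⊵ₗ N ≫ ModObj.smul := by
  rw [comp_actionHomLeft, Category.assoc, ModObj.mul_smul, MonoidalCategory.tensorHom_def,
    comp_actionHomLeft, whiskerRight_actionHomLeft, whiskerLeft_actionHomLeft]
  simp only [Category.assoc, Iso.inv_hom_id_assoc]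
  rw [← actionHomRight_comp_assoc, ← action_exchange_assoc]

section Ring

variable {C : Type*} [Category* C] [Preadditive C] [Linear k C] [MonoidalCategory C]
  [MonoidalPreadditive C] [IsFusionCategory k C] (σ : GrRingIso k (groupFusionRing G) C)
include σ

lemma GrRingIso.nonempty_tensor_iso (g h : G) :
    Nonempty ((σ.e g).rep ⊗ (σ.e h).rep ≅ (σ.e (g * h)).rep) := by
  have := IsFusionCategory.finite_hom (k := k) (C := C)
  have := IsFusionCategory.finite_simples (k := k) (C := C)
  refine nonempty_iso_rep_of_classOf k ?_
  have h1 := σ.map_mul (groupBasis G g) (groupBasis G h)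
  rw [groupBasis_mul] at h1
  rw [← grMul_single, ← toGr_basis (groupFusionRing G).basis σ.e g,
    ← toGr_basis (groupFusionRing G).basis σ.e h, ← toGr_basis (groupFusionRing G).basis σ.e]
  exact h1.symm

lemma GrRingIso.nonempty_unit_iso : Nonempty (𝟙_ C ≅ (σ.e 1).rep) := by
  have := IsFusionCategory.finite_hom (k := k) (C := C)
  have := IsFusionCategory.finite_simples (k := k) (C := C)
  refine nonempty_iso_rep_of_classOf k ?_
  rw [← σ.map_one, ← toGr_basis (groupFusionRing G).basis σ.e]
  exact congrArg _ (groupFusionRing G).basis_unit.symm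

/-- A fusion category with Grothendieck ring `ℤG` is pointed: `b_g ⊗ b_{g⁻¹}` has the class of the
unit, so it is isomorphic to the unit. -/
lemma GrRingIso.exists_tensor_inverse (X : C) (hX : Simple X) :
    ∃ Y : C, Nonempty (X ⊗ Y ≅ 𝟙_ C) ∧ Nonempty (Y ⊗ X ≅ 𝟙_ C) := by
  obtain ⟨g, hg⟩ := σ.e.surjective (SimpleClass.of X)
  obtain ⟨r⟩ := SimpleClass.nonempty_rep_of_iso X
  rw [← hg] at r
  obtain ⟨i⟩ := σ.nonempty_unit_iso
  obtain ⟨s⟩ := σ.nonempty_tensor_iso g g⁻¹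
  obtain ⟨t⟩ := σ.nonempty_tensor_iso g⁻¹ g
  rw [mul_inv_cancel] at s
  rw [inv_mul_cancel] at t
  exact ⟨(σ.e g⁻¹).rep, ⟨whiskerRightIso r.symm _ ≪≫ s ≪≫ i.symm⟩,
    ⟨whiskerLeftIso _ r.symm ≪≫ t ≪≫ i.symm⟩⟩

variable {σ}

/-- The action of `⨁_{h ∈ H} b_h` on the simple module of the coset `H` is universal. -/
lemma GrModIso.exists_isUniversalAction {H : Subgroup G} [Fintype H] {A : C} [MonObj A]
    [IsSemisimpleCategory (RightMod A)] (τ : GrModIso σ (cosetNIMRep H) (RightMod A)) :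
    ∃ φ : ∀ h : H, ((σ.e h).rep ⊙ₗ (τ.e (QuotientGroup.mk 1)).rep : RightMod A) ≅
      (τ.e (QuotientGroup.mk 1)).rep, IsUniversalAction (sumAction φ) := by
  have := IsFusionCategory.finite_hom (k := k) (C := C)
  have hact (g : G) : Nonempty (((σ.e g).rep ⊙ₗ (τ.e (QuotientGroup.mk 1)).rep : RightMod A) ≅
      (τ.e (QuotientGroup.mk g)).rep) := by
    have h := τ.nonempty_action_iso g (QuotientGroup.mk 1)
    rwa [show g • (QuotientGroup.mk 1 : G ⧸ H) = QuotientGroup.mk g from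
      congrArg QuotientGroup.mk (mul_one g)] at h
  have hH (h : H) : Nonempty (((σ.e h).rep ⊙ₗ (τ.e (QuotientGroup.mk 1)).rep : RightMod A) ≅
      (τ.e (QuotientGroup.mk 1)).rep) := by
    have h1 := hact h
    rwa [show (QuotientGroup.mk (h : G) : G ⧸ H) = QuotientGroup.mk 1 from
      (QuotientGroup.eq.2 (by simp)).symm] at h1
  refine ⟨fun h => (hH h).some, isUniversalAction_sumAction (k := k) _ ?_ ?_⟩
  · intro h h' e
    rw [← SimpleClass.of_eq_of_iff, SimpleClass.of_rep, SimpleClass.of_rep] at e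
    exact Subtype.ext (σ.e.injective e)
  · intro S hS
    obtain ⟨g, hg⟩ := σ.e.surjective (SimpleClass.of S)
    obtain ⟨r⟩ := SimpleClass.nonempty_rep_of_iso S
    rw [← hg] at r
    by_cases hgH : g ∈ H
    · exact Or.inl ⟨⟨g, hgH⟩, ⟨r.symm⟩⟩
    -- otherwise `S ⊙ N` is the simple module of the coset `g H`, which is not `H`
    · right
      obtain ⟨t⟩ := hact g
      let ψ : (S ⊙ₗ (τ.e (QuotientGroup.mk 1)).rep : RightMod A) ≅ (τ.e (QuotientGroup.mk g)).rep :=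
        asIso (r.inv ⊵ₗ _) ≪≫ t
      have := Simple.of_iso ψ
      refine hom_eq_zero_of_not_iso fun ⟨e⟩ => hgH ?_
      have h1 : Nonempty ((τ.e (QuotientGroup.mk g)).rep ≅ (τ.e (QuotientGroup.mk 1)).rep) :=
        ⟨ψ.symm ≪≫ e⟩
      rw [← SimpleClass.of_eq_of_iff, SimpleClass.of_rep, SimpleClass.of_rep] at h1
      have h2 := QuotientGroup.eq.1 (τ.e.injective h1)
      simpa using h2

open scoped MonObj in
/-- Any internal endomorphism algebra of the simple module of the coset `H` is a group algebra: it
is `⨁_{h ∈ H} b_h` by uniqueness of representing objects, and the multiplication on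
`b_h ⊗ b_{h'}` corresponds to the composite of two isomorphisms `b_h ⊙ N ≅ N`, hence to a nonzero
multiple of the one for `b_{h h'}`. -/
lemma GrModIso.isGroupAlgebra_of_isInternalEnd {H : Subgroup G} {A : C} [MonObj A]
    [IsSemisimpleCategory (RightMod A)] (τ : GrModIso σ (cosetNIMRep H) (RightMod A)) (E : C)
    [MonObj E] [ModObj E (τ.e (QuotientGroup.mk 1)).rep]
    (hE : IsInternalEnd (τ.e (QuotientGroup.mk 1)).rep E) :
    IsGroupAlgebra (fun g => (σ.e g).rep) H E := by
  have := IsFusionCategory.finite_hom (k := k) (C := C)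
  have := Fintype.ofFinite H
  have hE' : IsUniversalAction (ModObj.smul (M := E) (X := (τ.e (QuotientGroup.mk 1)).rep)) := hE
  obtain ⟨φ, hφ⟩ := τ.exists_isUniversalAction
  -- `θ` identifies `E` with `⨁ b_h`, and `j h` is the inclusion of the summand `b_h`
  obtain ⟨θ, hθ⟩ := hφ.exists_iso hE'
  let b (h : H) : C := (σ.e h).rep
  let j (h : H) : b h ⟶ E := biproduct.ι b h ≫ θ.hom
  have hj (h : H) : j h ⊵ₗ (τ.e (QuotientGroup.mk 1)).rep ≫ ModObj.smul = (φ h).hom := by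
    rw [comp_actionHomLeft, Category.assoc, hθ, ι_sumAction]
  refine ⟨j, ⟨IsColimit.ofIsoColimit (biproduct.isColimit b) (Cocone.ext θ fun _ => rfl)⟩,
    fun h h' => ?_⟩
  obtain ⟨t⟩ := σ.nonempty_tensor_iso (h : G) h'
  let ψ : (b h ⊗ b h' : C) ⊙ₗ (τ.e (QuotientGroup.mk 1)).rep ≅ (τ.e (QuotientGroup.mk 1)).rep :=
    αₗ (b h) (b h') (τ.e (QuotientGroup.mk 1)).rep ≪≫ asIso (b h ⊴ₗ (φ h').hom) ≪≫ φ h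
  let ψ' : (b h ⊗ b h' : C) ⊙ₗ (τ.e (QuotientGroup.mk 1)).rep ≅ (τ.e (QuotientGroup.mk 1)).rep :=
    asIso (t.hom ⊵ₗ (τ.e (QuotientGroup.mk 1)).rep) ≪≫ φ (h * h')
  have hmul : ((j h ⊗ₘ j h') ≫ μ[E]) ⊵ₗ (τ.e (QuotientGroup.mk 1)).rep ≫ ModObj.smul = ψ.hom := by
    rw [tensorHom_mul_actionHomLeft, hj, hj]
    rfl
  have hj' : (t.hom ≫ j (h * h')) ⊵ₗ (τ.e (QuotientGroup.mk 1)).rep ≫ ModObj.smul = ψ'.hom := by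
    rw [comp_actionHomLeft, Category.assoc, hj]
    rfl
  have : Simple ((b h ⊗ b h' : C) ⊙ₗ (τ.e (QuotientGroup.mk 1)).rep : RightMod A) := Simple.of_iso ψ
  obtain ⟨c, hc⟩ := exists_smul_of_iso k ψ' ψ.hom
  have hc0 : c ≠ 0 := by
    rintro rfl
    rw [zero_smul] at hc
    exact id_nonzero (τ.e (QuotientGroup.mk 1)).rep (by rw [← ψ.inv_hom_id, hc, comp_zero])
  -- the product of `b_h` and `b_{h'}` differs from the summand `b_{h h'}` by the scalar `c`
  refine ⟨⟨c • t.hom, c⁻¹ • t.inv, by simp [hc0, smul_smul], by simp [hc0, smul_smul]⟩,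
    hE'.hom_ext ?_⟩
  rw [hmul, Linear.smul_comp, smul_actionHomLeft, Linear.smul_comp, hj', hc]

end Ring

end Realized

/-! ### The realization of a coset NIM-rep by graded vector spaces -/

lemma IsOrthogonalFamily.classOf_eq {k : Type*} [Field k] [IsAlgClosed k] {D : Type*}
    [Category* D] [Preadditive D] [Linear k D] [HasFiniteBiproducts D] {J : Type*} {S : J → D}
    (hS : IsOrthogonalFamily k S) [Finite J] [∀ X Y : D, FiniteDimensional k (X ⟶ Y)] {X : D}
    {j : J} (h : Nonempty (X ≅ S j)) :
    classOf k X = Finsupp.single (hS.equivSimpleClass j) 1 := by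
  have := hS.isSemisimpleCategory
  have := hS.simple j
  obtain ⟨e⟩ := h
  have := Simple.of_iso e
  rw [classOf_simple, SimpleClass.of_eq_of_iff.2 ⟨e⟩]
  rfl

/-- Being a group algebra depends on the objects `b g` only up to isomorphism. -/
lemma IsGroupAlgebra.of_iso {C : Type*} [Category* C] [MonoidalCategory C] {G : Type*} [Group G]
    {b b' : G → C} {H : Subgroup G} {E : C} [MonObj E] (r : ∀ g, Nonempty (b g ≅ b' g))
    (hE : IsGroupAlgebra b' H E) : IsGroupAlgebra b H E := by
  let r g := (r g).some
  obtain ⟨j, ⟨hj⟩, hmul⟩ := hE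
  refine ⟨fun h => (r h).hom ≫ j h, ⟨?_⟩, fun h h' => ?_⟩
  · exact Cofan.IsColimit.mk _ (fun s => Cofan.IsColimit.desc hj fun h => (r h).inv ≫ s.inj h)
      (fun s h => by
        change ((r h).hom ≫ j h) ≫ _ = _
        rw [Category.assoc]
        exact (congrArg _ (Cofan.IsColimit.fac hj _ h)).trans (Iso.hom_inv_id_assoc _ _))
      (fun s m hm => Cofan.IsColimit.hom_ext hj _ _ fun h => by
        refine Eq.trans ?_ (Cofan.IsColimit.fac hj _ h).symm
        rw [← hm h]
        change j h ≫ m = _ ≫ ((r h).hom ≫ j h) ≫ m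
        rw [Category.assoc, Iso.inv_hom_id_assoc])
  · obtain ⟨t, ht⟩ := hmul h h'
    refine ⟨(r h ⊗ᵢ r h') ≪≫ t ≪≫ (r (h * h' : H)).symm, ?_⟩
    rw [← MonoidalCategory.tensorHom_comp_tensorHom, Category.assoc, ht]
    simp

namespace GradedVec

open RightMod

noncomputable section

attribute [local instance] subgroupFintype

variable (k : Type u) [Field k] [IsAlgClosed k] (G : Type v) [Group G] [Finite G]

/-- The Grothendieck ring of `G`-graded vector spaces is the group ring. -/
def ringIso : GrRingIso k (groupFusionRing G) (GradedVec.{u, v} k G) :=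
  GrRingIso.ofBasis isOrthogonalFamily_line.equivSimpleClass
    (isOrthogonalFamily_line.classOf_eq ⟨Iso.refl _⟩) fun g h => by
      have hg := (isOrthogonalFamily_line (k := k) (G := G)).nonempty_rep_iso g
      have hh := (isOrthogonalFamily_line (k := k) (G := G)).nonempty_rep_iso h
      refine Eq.trans ?_ (isOrthogonalFamily_line.classOf_eq
        ⟨(hg.some ⊗ᵢ hh.some) ≪≫ lineTensorIso g h⟩).symm
      exact (congrArg _ (groupBasis_mul g h)).trans (toGr_basis (groupFusionRing G).basis _ _)

lemma nonempty_ringIso_rep_iso (g : G) : Nonempty (((ringIso k G).e g).rep ≅ line k g) :=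
  isOrthogonalFamily_line.nonempty_rep_iso g

variable {G} (H : Subgroup G)

/-- The Grothendieck group of the category of modules over the group algebra of `H` is `ℤ[G/H]`. -/
def modIso : GrModIso (ringIso k G) (cosetNIMRep H) (RightMod (groupAlgebra k H)) :=
  GrModIso.ofBasis isOrthogonalFamily_cosetMod.equivSimpleClass fun g c => by
    have hg := nonempty_ringIso_rep_iso k G g
    have hc := (isOrthogonalFamily_cosetMod (k := k) (H := H)).nonempty_rep_iso c
    have hmem : (g • c).out⁻¹ * (g * c.out) ∈ H := by
      rw [← QuotientGroup.eq, QuotientGroup.out_eq', ← smul_eq_mul, ← MulAction.Quotient.smul_mk,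
        QuotientGroup.out_eq']
    refine Eq.trans ?_ (isOrthogonalFamily_cosetMod.classOf_eq
      ⟨asIso (hg.some.hom ⊙ₗₘ hc.some.hom) ≪≫
        (αₗ (line k g) (line k c.out) (regular (groupAlgebra k H))).symm ≪≫
        (free _).mapIso (lineTensorIso g c.out) ≪≫ freeLineIso hmem⟩).symm
    exact (congrArg _ (smul_cosetBasis H g c)).trans (toGr_basis (cosetNIMRep H).basis _ _)

/-- The realization of the NIM-rep of cosets of `H` by the group algebra of `H` in graded vector
spaces. -/
def realization : Realization.{u, max u v, (max u v) + 1} k (cosetNIMRep H) where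
  cat := ⟨GradedVec.{u, v} k G⟩
  ringIso := ringIso k G
  alg := groupAlgebra k H
  modIso := modIso k H

lemma isGroupAlgebra_realization :
    IsGroupAlgebra (realization k H).b H (realization k H).alg :=
  IsGroupAlgebra.of_iso (C := GradedVec.{u, v} k G) (b' := line k) (E := groupAlgebra k H)
    (nonempty_ringIso_rep_iso k G)
    ⟨lineIncl, ⟨groupAlgebraIsColimit⟩, fun h h' => ⟨_, lineIncl_tensor_mul h h'⟩⟩

lemma nonempty_realization_m_iso :
    Nonempty ((realization k H).m (QuotientGroup.mk 1) ≅ regular (realization k H).alg) := by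
  obtain ⟨r⟩ :=
    (isOrthogonalFamily_cosetMod (k := k) (H := H)).nonempty_rep_iso (QuotientGroup.mk 1)
  have hmem : (1 : G)⁻¹ * (QuotientGroup.mk 1 : G ⧸ H).out ∈ H := by
    rw [← QuotientGroup.eq, QuotientGroup.out_eq']
  exact ⟨r ≪≫ freeLineIso hmem ≪≫ mkIso (λ_ (groupAlgebra k H)) (unit_compat _)⟩

end

end GradedVec

lemma Realization.isPointed {k : Type u} [Field k] [IsAlgClosed k] {G : Type v} [Group G]
    [Finite G] {A : Type w₃} [AddCommGroup A] [Module (MonoidAlgebra ℤ G) A] {L : Type w₄}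
    {N : NIMRep (groupFusionRing G) A L} (ρ : Realization.{u, w₁, w₂} k N) : ρ.cat.IsPointed :=
  ρ.ringIso.exists_tensor_inverse

lemma NIMRep.Equivalent.isAdmissible {k : Type u} [Field k] {R I : Type*} [Ring R] [Finite I]
    {F : FusionRing R I} {A : Type*} [AddCommGroup A] [Module R A] {L : Type*}
    {N : NIMRep F A L} {A' : Type*} [AddCommGroup A'] [Module R A'] {L' : Type*}
    {N' : NIMRep F A' L'} (h : N.Equivalent N') (h' : N'.IsAdmissible.{u, w₁, w₂} k) :
    N.IsAdmissible.{u, w₁, w₂} k := by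
  obtain ⟨e, f, hf⟩ := h
  obtain ⟨ρ⟩ := h'
  exact ⟨{
    cat := ρ.cat
    ringIso := ρ.ringIso
    alg := ρ.alg
    modIso := ρ.modIso.ofEquivalent e f hf }⟩

lemma Realization.exists_isInternalEnd {k : Type u} [Field k] [IsAlgClosed k] {G : Type v}
    [Group G] [Finite G] {H : Subgroup G} (ρ : Realization.{u, w₁, w₂} k (cosetNIMRep H)) :
    ∃ (E : ρ.cat.carrier) (_ : MonObj E) (_ : ModObj E (ρ.m (QuotientGroup.mk 1))),
      IsInternalEnd (ρ.m (QuotientGroup.mk 1)) E := by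
  have := Fintype.ofFinite H
  obtain ⟨φ, hφ⟩ := ρ.modIso.exists_isUniversalAction
  exact ⟨_, hφ.monObj, hφ.modObj, hφ⟩

end GroupNIM

theorem mainTheorem7 (k : Type u) [Field k] [IsAlgClosed k] (G : Type v) [Group G] [Finite G] :
    -- every irreducible NIM-rep is equivalent to some `M(H)`, and it is admissible; the fusion
    -- categories involved are pointed
    (∀ (A : Type w₃) [AddCommGroup A] [Module (MonoidAlgebra ℤ G) A] (L : Type w₄)
      (N : NIMRep (groupFusionRing G) A L), N.IsIrreducible →
        (∃ H : Subgroup G, N.Equivalent (cosetNIMRep H)) ∧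
        N.IsAdmissible.{u, max u v, (max u v) + 1} k ∧
        ∀ ρ : Realization.{u, w₁, w₂} k N, ρ.cat.IsPointed) ∧
    ∀ H : Subgroup G,
      (cosetNIMRep H).IsIrreducible ∧
      -- `M(H)` comes from modules over a group algebra `⨁_{h ∈ H} b_h`, with the coset `H`
      -- corresponding to the regular module
      (∃ ρ : Realization.{u, max u v, (max u v) + 1} k (cosetNIMRep H), ρ.cat.IsPointed ∧
        IsGroupAlgebra ρ.b H ρ.alg ∧
        Nonempty (ρ.m (QuotientGroup.mk 1) ≅ RightMod.regular ρ.alg)) ∧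
      -- in every realization of `M(H)`, the internal endomorphism algebra of the simple module
      -- corresponding to the coset `H` exists and is a group algebra `⨁_{h ∈ H} b_h`
      (∀ ρ : Realization.{u, w₁, w₂} k (cosetNIMRep H),
        (∃ (E : ρ.cat.carrier) (_ : MonObj E) (_ : ModObj E (ρ.m (QuotientGroup.mk 1))),
          IsInternalEnd (ρ.m (QuotientGroup.mk 1)) E) ∧
        ∀ (E : ρ.cat.carrier) [MonObj E] [ModObj E (ρ.m (QuotientGroup.mk 1))],
          IsInternalEnd (ρ.m (QuotientGroup.mk 1)) E → IsGroupAlgebra ρ.b H E)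
 := by
  refine ⟨fun A _ _ L N hN => ?_, fun H => ⟨cosetNIMRep_isIrreducible H, ?_, fun ρ => ⟨?_, ?_⟩⟩⟩
  · obtain ⟨H, hH⟩ := hN.exists_equivalent
    exact ⟨⟨H, hH⟩, hH.isAdmissible ⟨GradedVec.realization k H⟩, fun ρ => ρ.isPointed⟩
  · exact ⟨GradedVec.realization k H, (GradedVec.realization k H).isPointed,
      GradedVec.isGroupAlgebra_realization k H, GradedVec.nonempty_realization_m_iso k H⟩
  · exact ρ.exists_isInternalEnd
  · intro E _ hact hE
    let _ : ModObj E (ρ.modIso.e (QuotientGroup.mk 1)).rep := hact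
    exact ρ.modIso.isGroupAlgebra_of_isInternalEnd E hE
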